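/- **Theorem (Explicit Noether normalization for affine varieties).** *Conventions.* Let $\mathbb{F}$ be a field with algebraic closure $\overline{\mathbb{F}}$. An affine variety $V\subseteq\mathbb{A}^n_{\mathbb{F}}$ over $\mathbb{F}$ is the set of common zeros in $\overline{\mathbb{F}}^n$ of a set of polynomials in $\mathbb{F}[X_1,\dots,X_n]$ (so $V$ may be reducible or empty); $I(V)\subseteq\mathbb{F}[X_1,\dots,X_n]$ is the ideal of polynomials vanishing on $V$, and $\mathbb{F}[V]=\mathbb{F}[X_1,\dots,X_n]/I(V)$. The dimension of $V$ is the largest length $r$ of a chain $V_0\subsetneq\cdots\subsetneq V_r$ of irreducible affine subvarieties of $V$ over $\mathbb{F}$. The degree of $V$ is the sum of the degrees of the irreducible components of $V$ over $\overline{\mathbb{F}}$, where the degree of an irreducible variety $W$ over $\overline{\mathbb{F}}$ is the number of points in which $W$ meets an affine subspace of codimension $\dim W$ in general position. Polynomials $f_1,\dots,f_m\in\mathbb{F}[X_1,\dots,X_n]$ define a finite morphism $V\to\mathbb{A}^m_{\mathbb{F}}$ if $\mathbb{F}[V]$ is a finitely generated module over the image of $\mathbb{F}[Y_1,\dots,Y_m]\to\mathbb{F}[V]$,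 $Y_i\mapsto f_i+I(V)$. *The map.* Let $n,d\ge 1$ and $m,k\in\{1,\dots,n\}$. Let $d_1,\dots,d_n$ be pairwise coprime integers greater than $d$, and let $M=(c_{i,j})\in\mathbb{F}^{m\times n}$ be $k$-regular, i.e. any $k$ distinct columns of $M$ are linearly independent. Let $\varphi=\varphi_{M}:\mathbb{A}^n_{\mathbb{F}}\to\mathbb{A}^m_{\mathbb{F}}$ be the polynomial map defined by $f_i=\sum_{j=1}^n c_{i,j}X_j^{d_j}$, $1\le i\le m$. 1. For every affine variety $V\subseteq\mathbb{A}^n_{\mathbb{F}}$ over $\mathbb{F}$ of dimension at most $k$ and degree at most $d$, the restriction $\varphi|_V:V\to\mathbb{A}^m_{\mathbb{F}}$ is a finite morphism. 2. Consequently there is a universal Noether normalization map of polynomial degree: there is an absolute constant $C>0$ such that for all $n,d\ge 1$ there are pairwise coprime integers $d_1,\dots,d_n>d$ with the following property. For every field $\mathbb{F}$, every $k\in\{1,\dots,n\}$ and all distinct $\omega_1,\dots,\omega_n\in\mathbb{F}$, the Vandermonde matrix $M=(\omega_j^{\,i-1})_{1\le i\le k,\,1\le j\le n}$ is $k$-regular,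 the polynomials $f_1,\dots,f_k$ defining $\varphi_M:\mathbb{A}^n_{\mathbb{F}}\to\mathbb{A}^k_{\mathbb{F}}$ have degree at most $C\,(n+d)\log(n+d)$, and $\varphi_M|_V:V\to\mathbb{A}^k_{\mathbb{F}}$ is a finite morphism for every affine variety $V\subseteq\mathbb{A}^n_{\mathbb{F}}$ over $\mathbb{F}$ of dimension at most $k$ and degree at most $d$. -/

import Mathlib

/-! Affine varieties over a field `F`, following the elementary convention: the affine space
`𝔸ⁿ` over `F` is the set `Kⁿ`, where `K` is an algebraic closure of `F`, and its closed subsets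
are the zero sets of polynomials with coefficients in `F`. The same definitions with `F = K` give
the varieties over the algebraically closed field. -/

namespace ExplicitNoether

noncomputable section

variable (F : Type*) {K : Type*} [Field F] [Field K] [Algebra F K] {n m : ℕ}

/-- `V ⊆ Kⁿ` is an affine variety over `F`: the set of common zeros of a set of polynomials with
coefficients in `F`. -/
def IsAffineVariety (V : Set (Fin n → K)) : Prop :=
  ∃ S : Set (MvPolynomial (Fin n) F), V = {x | ∀ p ∈ S, MvPolynomial.aeval x p = 0}

/-- An irreducible affine variety over `F`: nonempty, and not the union of two proper affine
subvarieties over `F`. -/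
def IsIrreducibleVariety (V : Set (Fin n → K)) : Prop :=
  IsAffineVariety F V ∧ V.Nonempty ∧
    ∀ W₁ W₂ : Set (Fin n → K), IsAffineVariety F W₁ → IsAffineVariety F W₂ →
      V = W₁ ∪ W₂ → W₁ = V ∨ W₂ = V

/-- `W` is an irreducible component over `F` of `V`: a maximal irreducible subvariety. -/
def IsIrreducibleComponent (V W : Set (Fin n → K)) : Prop :=
  Maximal (fun W : Set (Fin n → K) => IsIrreducibleVariety F W ∧ W ⊆ V) W

/-- The dimension over `F` of an affine variety `V`: the supremum of the lengths `r` of chains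
`V₀ ⊊ V₁ ⊊ ⋯ ⊊ V_r` of irreducible subvarieties of `V` (`⊥` for the empty variety). -/
def affineDim (V : Set (Fin n → K)) : WithBot ℕ∞ :=
  Order.krullDim {W : Set (Fin n → K) // IsIrreducibleVariety F W ∧ W ⊆ V}

/-- For `V ⊆ Kⁿ` (`K` algebraically closed) and `D : ℕ∞`: an affine subspace of codimension `r` in
general position meets `V` in exactly `D` points. The affine subspaces of codimension `r` are the
solution sets of the linear systems `A x = b` with `A` an `r × n` matrix of rank `r`, and
general position means that the coefficients `(A, b)` lie in a nonempty principal Zariski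
open set `G ≠ 0`. -/
def GeneralSectionCount (V : Set (Fin n → K)) (r : ℕ) (D : ℕ∞) : Prop :=
  ∃ G : MvPolynomial ((Fin r × Fin n) ⊕ Fin r) K, G ≠ 0 ∧
    ∀ (A : Matrix (Fin r) (Fin n) K) (b : Fin r → K), A.rank = r →
      MvPolynomial.eval (Sum.elim (fun ij => A ij.1 ij.2) b) G ≠ 0 →
        (V ∩ {x | A.mulVec x = b}).encard = D

/-- The degree of an irreducible affine variety `V` over the algebraically closed field `K`: the
number of points of intersection with an affine subspace of codimension `dim V` in general
position. (There is exactly one such `D`, so the infimum just picks it.) -/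
def irreducibleDegree (V : Set (Fin n → K)) : ℕ∞ :=
  sInf {D : ℕ∞ | ∃ r : ℕ, affineDim K V = (r : WithBot ℕ∞) ∧ GeneralSectionCount V r D}

/-- The degree of an affine variety `V ⊆ Kⁿ` (`K` algebraically closed): the sum of the degrees of
its irreducible components over `K`. (There are finitely many components, so the supremum of
the partial sums is their sum.) For a variety over a subfield `F` of which `K` is the algebraic
closure, this is by definition also its degree. -/
def affineDegree (V : Set (Fin n → K)) : ℕ∞ :=
  ⨆ s : Finset {W : Set (Fin n → K) // IsIrreducibleComponent K V W},
    ∑ W ∈ s, irreducibleDegree W.1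

/-- The coordinate ring `F[V] = F[X₁, …, Xₙ] / I(V)`. -/
abbrev CoordinateRing (V : Set (Fin n → K)) : Type _ :=
  MvPolynomial (Fin n) F ⧸ MvPolynomial.vanishingIdeal F V

variable {F}

/-- The map `Kⁿ → Kᵐ`, `a ↦ (f₁(a), …, f_m(a))`, defined by polynomials over `F`. -/
def polyMap (K : Type*) [Field K] [Algebra F K] (f : Fin m → MvPolynomial (Fin n) F) :
    (Fin n → K) → (Fin m → K) :=
  fun a i => MvPolynomial.aeval a (f i)

theorem aeval_polyMap (f : Fin m → MvPolynomial (Fin n) F) (a : Fin n → K)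
    (p : MvPolynomial (Fin m) F) :
    MvPolynomial.aeval (polyMap K f a) p = MvPolynomial.aeval a (MvPolynomial.aeval f p) :=
  (MvPolynomial.comp_aeval_apply f (MvPolynomial.aeval a) p).symm

theorem vanishingIdeal_le_comap (f : Fin m → MvPolynomial (Fin n) F)
    {V : Set (Fin n → K)} {V' : Set (Fin m → K)} (h : Set.MapsTo (polyMap K f) V V') :
    MvPolynomial.vanishingIdeal F V' ≤
      (MvPolynomial.vanishingIdeal F V).comap (MvPolynomial.aeval f) := by
  intro p hp a ha
  rw [← aeval_polyMap]
  exact hp _ (h ha)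

/-- The homomorphism `φ^♯ : F[V'] → F[V]`, `Y_i + I(V') ↦ f_i + I(V)`, associated with the morphism
`φ : V → V'` defined by `f₁, …, f_m`. -/
def comorphism (f : Fin m → MvPolynomial (Fin n) F)
    {V : Set (Fin n → K)} {V' : Set (Fin m → K)} (h : Set.MapsTo (polyMap K f) V V') :
    CoordinateRing F V' →ₐ[F] CoordinateRing F V :=
  Ideal.quotientMapₐ (MvPolynomial.vanishingIdeal F V) (MvPolynomial.aeval f)
    (vanishingIdeal_le_comap f h)

/-- The morphism `V → V'` defined by `f₁, …, f_m` is finite: `F[V]` is a finitely generated module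
over its subring `φ^♯(F[V'])`. -/
def IsFiniteMorphism (f : Fin m → MvPolynomial (Fin n) F)
    {V : Set (Fin n → K)} {V' : Set (Fin m → K)} (h : Set.MapsTo (polyMap K f) V V') : Prop :=
  Module.Finite (comorphism f h).range (CoordinateRing F V)

/-- The restriction to `V` of the polynomial map `𝔸ⁿ → 𝔸ᵐ` defined by `f₁, …, f_m` is a finite
morphism `V → 𝔸ᵐ`. -/
def RestrictsToFinite (f : Fin m → MvPolynomial (Fin n) F) (V : Set (Fin n → K)) : Prop :=
  IsFiniteMorphism f (V := V) (V' := Set.univ) (Set.mapsTo_univ (polyMap K f) V)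

/-- A matrix is `k`-regular if any `k` distinct columns are linearly independent. -/
def IsRegularMatrix (k : ℕ) (M : Matrix (Fin m) (Fin n) F) : Prop :=
  ∀ J : Finset (Fin n), J.card = k →
    LinearIndependent F (fun j : J => fun i : Fin m => M i j)

/-- The `k × n` Vandermonde matrix with entries `ω_j ^ (i - 1)`, `1 ≤ i ≤ k`, `1 ≤ j ≤ n`. -/
def vandermondeMatrix (k : ℕ) (ω : Fin n → F) : Matrix (Fin k) (Fin n) F :=
  fun i j => ω j ^ (i : ℕ)

/-- The polynomials `f_i = ∑_j c_{i,j} X_j ^ {d_j}`. -/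
def dklPoly (M : Matrix (Fin m) (Fin n) F) (e : Fin n → ℕ) (i : Fin m) :
    MvPolynomial (Fin n) F :=
  ∑ j, MvPolynomial.C (M i j) * MvPolynomial.X j ^ e j

end

end ExplicitNoether

/-! In any `k + 1` coordinates the points of `V` satisfy a nonzero equation of degree at most `d`
over `K` (a form of Perron's theorem). For an irreducible component, `r` general linear forms are
algebraically independent, and adjoining one more coordinate yields an irreducible relation; after
a shear, each root of that relation above a general point lifts to a point of a general linear
section, so its degree is at most the number of points of the section. The coordinates in question
are then reached by specialization, because linear independence of the monomials is an open
condition.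

Integrality is checked on the valuation rings of fields `L` with a homomorphism `K[V] → L`. If some
coordinate `x_j` does not lie in the valuation ring, let `γ > 1` be the largest of the values
`v(x_j) ^ d_j`. It is attained for more than `k` indices: otherwise, by `k`-regularity, some linear
combination of the `f_i`, whose value is at most `1`, contains exactly one term of value `γ`. But in
`k + 1` of these coordinates all exponents of the equation are less than the pairwise coprime `d_j`,
so by the Chinese remainder theorem its monomials have pairwise different values and cannot cancel.
Small primes `d_j` exist by Chebyshev's estimate. -/

namespace ExplicitNoether

open MvPolynomial

section Dimension

variable {R S : Type*} [CommRing R] [CommRing S] {f : R →+* S}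

theorem ringKrullDim_le_of_isIntegral (hf : f.IsIntegral) : ringKrullDim S ≤ ringKrullDim R := by
  algebraize [f]
  exact Order.krullDim_le_of_strictMono (PrimeSpectrum.comap (algebraMap R S)) fun _ _ h =>
    Ideal.IsIntegral.comap_lt_comap h

theorem ringKrullDim_eq_of_isIntegral_of_injective (hf : f.IsIntegral)
    (hinj : Function.Injective f) : ringKrullDim S = ringKrullDim R := by
  refine le_antisymm (ringKrullDim_le_of_isIntegral hf) (iSup_le fun l => ?_)
  algebraize [f]
  have : FaithfulSMul R S := (faithfulSMul_iff_algebraMap_injective R S).mpr hinj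
  obtain ⟨P, _, _⟩ := (Ideal.nonempty_primesOver (S := S) (RelSeries.head l).asIdeal).some
  obtain ⟨L, hL, -⟩ := Ideal.exists_ltSeries_of_hasGoingUp l P
  exact hL ▸ Order.LTSeries.length_le_krullDim L

theorem trdeg_eq_of_ringKrullDim_eq {k : Type*} [Field k] [IsDomain R] [Algebra k R]
    [Algebra.FiniteType k R] {r : ℕ} (h : ringKrullDim R = r) : Algebra.trdeg k R = r := by
  obtain ⟨s, g, hg, hint⟩ := exists_integral_inj_algHom_of_fg k R
  obtain rfl : s = r := by
    have hdim := ringKrullDim_eq_of_isIntegral_of_injective hint hg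
    rw [MvPolynomial.ringKrullDim_of_isNoetherianRing, ringKrullDim_eq_zero_of_field, h,
      Nat.card_fin, zero_add] at hdim
    exact_mod_cast hdim.symm
  algebraize [g.toRingHom]
  have : IsScalarTower k (MvPolynomial (Fin s) k) R := IsScalarTower.of_algHom g
  have : FaithfulSMul (MvPolynomial (Fin s) k) R :=
    (faithfulSMul_iff_algebraMap_injective _ _).mpr hg
  have hadd := lift_trdeg_add_eq k (MvPolynomial (Fin s) k) R
  rw [trdeg_eq_zero (R := MvPolynomial (Fin s) k) (A := R),
    MvPolynomial.trdeg_of_isDomain] at hadd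
  simpa only [Cardinal.mk_fin, Cardinal.lift_natCast, Cardinal.lift_zero, add_zero,
    Cardinal.lift_id, Cardinal.lift_eq_nat_iff, eq_comm] using hadd

end Dimension

section Varieties

variable {F K : Type*} [Field F] [Field K] [Algebra F K] {n : ℕ} {V W : Set (Fin n → K)}

theorem isAffineVariety_zeroLocus (I : Ideal (MvPolynomial (Fin n) F)) :
    IsAffineVariety F (zeroLocus K I) :=
  ⟨I, rfl⟩

theorem isAffineVariety_iff : IsAffineVariety F V ↔ zeroLocus K (vanishingIdeal F V) = V := by
  constructor
  · rintro ⟨S, rfl⟩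
    rw [← zeroLocus_span]
    exact zeroLocus_vanishingIdeal_galoisConnection.l_u_l_eq_l _
  · intro h
    exact h ▸ isAffineVariety_zeroLocus _

theorem IsAffineVariety.baseChange (hV : IsAffineVariety F V) : IsAffineVariety K V := by
  obtain ⟨S, rfl⟩ := hV
  refine ⟨MvPolynomial.map (algebraMap F K) '' S, ?_⟩
  ext x
  simp [aeval_def]

theorem IsAffineVariety.subset_of_vanishingIdeal_le (hV : IsAffineVariety F V)
    (h : vanishingIdeal F V ≤ vanishingIdeal F W) : W ⊆ V := fun x hx =>
  isAffineVariety_iff.mp hV ▸ fun _ hp => h hp x hx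

theorem IsAffineVariety.inter_setOf_aeval_eq_zero (hV : IsAffineVariety F V)
    (p : MvPolynomial (Fin n) F) : IsAffineVariety F (V ∩ {x | aeval x p = 0}) := by
  obtain ⟨S, rfl⟩ := hV
  refine ⟨insert p S, ?_⟩
  ext x
  simp [and_comm]

theorem IsIrreducibleVariety.isPrime (hV : IsIrreducibleVariety F V) :
    (vanishingIdeal F V).IsPrime := by
  obtain ⟨hVa, ⟨x₀, hx₀⟩, hirr⟩ := hV
  refine ⟨fun h => ?_, fun {p q} hpq => ?_⟩
  · have h1 : (1 : MvPolynomial (Fin n) F) ∈ vanishingIdeal F V := h ▸ Submodule.mem_top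
    simpa using h1 x₀ hx₀
  · have hcover : V = V ∩ {x | aeval x p = 0} ∪ V ∩ {x | aeval x q = 0} := by
      rw [← Set.inter_union_distrib_left, eq_comm, Set.inter_eq_left]
      exact fun x hx => by simpa using hpq x hx
    exact (hirr _ _ (hVa.inter_setOf_aeval_eq_zero p) (hVa.inter_setOf_aeval_eq_zero q)
      hcover).imp Set.inter_eq_left.mp Set.inter_eq_left.mp

variable [IsAlgClosed K]

theorem isIrreducibleVariety_zeroLocus (P : Ideal (MvPolynomial (Fin n) F)) [hP : P.IsPrime] :
    IsIrreducibleVariety F (zeroLocus K P) := by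
  have hvan : vanishingIdeal F (zeroLocus K P) = P := IsPrime.vanishingIdeal_zeroLocus P
  refine ⟨isAffineVariety_zeroLocus P, ?_, fun W₁ W₂ h₁ h₂ h => ?_⟩
  · by_contra hne
    rw [Set.not_nonempty_iff_eq_empty] at hne
    rw [hne, vanishingIdeal_empty] at hvan
    exact hP.ne_top hvan.symm
  · have hle : vanishingIdeal F W₁ * vanishingIdeal F W₂ ≤ P := by
      refine Ideal.mul_le.mpr fun p hp q hq => hvan ▸ fun x hx => ?_
      rw [map_mul, mul_eq_zero]
      exact (h ▸ hx : x ∈ W₁ ∪ W₂).imp (hp x) (hq x)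
    rw [← hvan] at hle hP
    exact (hP.mul_le.mp hle).imp
      (fun hPle => Set.Subset.antisymm (h ▸ Set.subset_union_left)
        (h₁.subset_of_vanishingIdeal_le hPle))
      (fun hPle => Set.Subset.antisymm (h ▸ Set.subset_union_right)
        (h₂.subset_of_vanishingIdeal_le hPle))

/-- The order-reversing correspondence between the irreducible subvarieties of `V` and the prime
ideals containing `I(V)`. -/
noncomputable def irreducibleSubvarietyOrderIso (hV : IsAffineVariety F V) :
    {W : Set (Fin n → K) // IsIrreducibleVariety F W ∧ W ⊆ V} ≃o
      (PrimeSpectrum.zeroLocus (vanishingIdeal F V : Set (MvPolynomial (Fin n) F)))ᵒᵈ where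
  toFun W := OrderDual.toDual
    ⟨⟨vanishingIdeal F W.1, W.2.1.isPrime⟩, vanishingIdeal_anti_mono W.2.2⟩
  invFun P := ⟨zeroLocus K (OrderDual.ofDual P).1.asIdeal, isIrreducibleVariety_zeroLocus _, by
    conv_rhs => rw [← isAffineVariety_iff.mp hV]
    exact zeroLocus_anti_mono (OrderDual.ofDual P).2⟩
  left_inv W := Subtype.ext (isAffineVariety_iff.mp W.2.1.1)
  right_inv P := OrderDual.ofDual.injective <| Subtype.ext <| PrimeSpectrum.ext <|
    IsPrime.vanishingIdeal_zeroLocus _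
  map_rel_iff' {_ W} := ⟨W.2.1.1.subset_of_vanishingIdeal_le, vanishingIdeal_anti_mono⟩

theorem affineDim_eq_ringKrullDim (hV : IsAffineVariety F V) :
    affineDim F V = ringKrullDim (CoordinateRing F V) := by
  rw [affineDim, Order.krullDim_eq_of_orderIso (irreducibleSubvarietyOrderIso hV),
    Order.krullDim_orderDual, ringKrullDim_quotient]

end Varieties

section BaseChange

variable (F : Type*) {K : Type*} [Field F] [Field K] [Algebra F K] {n : ℕ}
  {V W : Set (Fin n → K)}

/-- Restriction of functions `F[V] → K[W]` for `W ⊆ V`, combined with the extension of scalars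
from `F` to `K`. -/
noncomputable def coordinateRingMap (h : W ⊆ V) : CoordinateRing F V →+* CoordinateRing K W :=
  Ideal.quotientMap (vanishingIdeal K W) (MvPolynomial.map (algebraMap F K)) fun p hp x hx => by
    rw [aeval_map_algebraMap]
    exact hp x (h hx)

theorem coordinateRingMap_mk (h : W ⊆ V) (p : MvPolynomial (Fin n) F) :
    coordinateRingMap F h (Ideal.Quotient.mk _ p) =
      Ideal.Quotient.mk _ (MvPolynomial.map (algebraMap F K) p) :=
  Ideal.quotientMap_mk

theorem coordinateRingMap_injective :
    Function.Injective (coordinateRingMap F (subset_refl V)) :=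
  Ideal.quotientMap_injective' fun p hp x hx => by
    rw [← aeval_map_algebraMap K]
    exact hp x hx

theorem isIntegral_coordinateRingMap [Algebra.IsAlgebraic F K] (h : W ⊆ V) :
    (coordinateRingMap F h).IsIntegral := by
  let := algebraMvPolynomial (R := F) (S := K) (σ := Fin n)
  refine RingHom.IsIntegral.tower_top (Ideal.Quotient.mk _) _ ?_
  rw [show (coordinateRingMap F h).comp (Ideal.Quotient.mk _) = (Ideal.Quotient.mk _).comp
    (algebraMap (MvPolynomial (Fin n) F) (MvPolynomial (Fin n) K)) from
    RingHom.ext (coordinateRingMap_mk F h)]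
  exact RingHom.IsIntegral.trans _ _ (algebraMap_isIntegral_iff.mpr inferInstance)
    (RingHom.isIntegral_of_surjective _ Ideal.Quotient.mk_surjective)

theorem affineDim_le_affineDim_of_subset [IsAlgClosed K] [Algebra.IsAlgebraic F K]
    (hV : IsAffineVariety F V) (hW : IsAffineVariety K W) (h : W ⊆ V) :
    affineDim K W ≤ affineDim F V := by
  rw [affineDim_eq_ringKrullDim hV, affineDim_eq_ringKrullDim hW]
  exact ringKrullDim_le_of_isIntegral (isIntegral_coordinateRingMap F h)

end BaseChange

section MvPolynomials

variable {σ τ R : Type*} [CommRing R]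

theorem exists_eval_ne_zero [IsDomain R] [Infinite R] {p : MvPolynomial σ R} (hp : p ≠ 0) :
    ∃ x, eval x p ≠ 0 := by
  by_contra! h
  exact hp (MvPolynomial.funext fun x => by simpa using h x)

theorem totalDegree_aeval_le_of_totalDegree_le_one {f : σ → MvPolynomial τ R}
    (hf : ∀ i, (f i).totalDegree ≤ 1) (p : MvPolynomial σ R) :
    (aeval f p).totalDegree ≤ p.totalDegree := by
  rw [aeval_def, eval₂_eq]
  refine totalDegree_finsetSum_le fun α hα => ?_
  calc (algebraMap R (MvPolynomial τ R) (coeff α p) * ∏ i ∈ α.support, f i ^ α i).totalDegree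
      ≤ 0 + (∏ i ∈ α.support, f i ^ α i).totalDegree := by
        rw [algebraMap_eq, ← totalDegree_C (σ := τ) (coeff α p)]
        exact totalDegree_mul _ _
    _ ≤ ∑ i ∈ α.support, (f i ^ α i).totalDegree := by
        rw [zero_add]
        exact totalDegree_finsetProd _ _
    _ ≤ ∑ i ∈ α.support, α i := Finset.sum_le_sum fun i _ =>
        (totalDegree_pow _ _).trans (by simpa using Nat.mul_le_mul_left (α i) (hf i))
    _ ≤ p.totalDegree := le_totalDegree hα

theorem coeff_aeval_C_mul_X (w : σ → R) (p : MvPolynomial σ R) (e : ℕ) :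
    (aeval (fun i => Polynomial.C (w i) * Polynomial.X) p : Polynomial R).coeff e =
      eval w (homogeneousComponent e p) := by
  classical
  induction p using MvPolynomial.induction_on' with
  | monomial α a =>
    have hprod : (α.prod fun i k => (Polynomial.C (w i) * Polynomial.X) ^ k : Polynomial R) =
        Polynomial.C (α.prod fun i k => w i ^ k) * Polynomial.X ^ α.degree := by
      simp [mul_pow, Finsupp.prod, Finset.prod_mul_distrib, Finset.prod_pow_eq_pow_sum,
        Finsupp.degree_apply]
    rw [aeval_monomial, hprod, ← mul_assoc, Polynomial.algebraMap_eq, ← Polynomial.C_mul,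
      Polynomial.coeff_C_mul_X_pow, homogeneousComponent_apply,
      Finset.sum_congr (Finset.filter_congr_decidable _ _ _) fun _ _ => rfl]
    by_cases ha : a = 0
    · simp [ha]
    · rw [support_monomial, if_neg ha, Finset.filter_singleton]
      by_cases he : e = α.degree
      · simp [he, eval_monomial]
      · simp [he, Ne.symm he]
  | add p q hp hq => simp [hp, hq]

theorem derivative_aeval [Fintype σ] (f : σ → Polynomial R) (p : MvPolynomial σ R) :
    Polynomial.derivative (aeval f p) =
      ∑ i, aeval f (pderiv i p) * Polynomial.derivative (f i) := by
  classical
  induction p using MvPolynomial.induction_on with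
  | C a => simp [Polynomial.algebraMap_eq]
  | add p q hp hq => simp [hp, hq, add_mul, Finset.sum_add_distrib]
  | mul_X p j hp =>
    have hX : ∑ i, aeval f (p * pderiv i (X j)) * Polynomial.derivative (f i) =
        aeval f p * Polynomial.derivative (f j) := by
      rw [Finset.sum_eq_single j] <;> simp +contextual [pderiv_X, eq_comm]
    simp only [map_mul, aeval_X, Polynomial.derivative_mul, hp, Derivation.leibniz, smul_eq_mul,
      map_add, add_mul, Finset.sum_add_distrib] at hX ⊢
    rw [hX, add_comm, Finset.sum_mul]
    exact congrArg _ (Finset.sum_congr rfl fun i _ => by ring)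

theorem cast_eq_zero_of_pderiv_eq_zero [NoZeroDivisors R] {P : MvPolynomial σ R}
    (h : ∀ i, pderiv i P = 0) {α : σ →₀ ℕ} (hα : α ∈ P.support) (i : σ) : (α i : R) = 0 := by
  by_cases hαi : α i = 0
  · simp [hαi]
  have hsub : α - Finsupp.single i 1 + Finsupp.single i 1 = α :=
    tsub_add_cancel_of_le (by simpa [Nat.one_le_iff_ne_zero] using hαi)
  have hcoeff : coeff (α - Finsupp.single i 1) (pderiv i P) = 0 := by rw [h i, coeff_zero]
  rw [coeff_pderiv, hsub] at hcoeff
  have hcast := (mul_eq_zero.mp hcoeff).resolve_left (mem_support_iff.mp hα)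
  rw [← hsub]
  simpa using hcast

theorem exists_eq_C_of_pderiv_eq_zero [NoZeroDivisors R] [CharZero R] {P : MvPolynomial σ R}
    (h : ∀ i, pderiv i P = 0) : ∃ c, P = C c := by
  classical
  refine ⟨coeff 0 P, MvPolynomial.ext _ _ fun α => ?_⟩
  rw [coeff_C]
  split_ifs with h0
  · rw [h0]
  · by_contra hne
    exact h0 <| Finsupp.ext fun i => Eq.symm <| Nat.cast_eq_zero.mp <|
      cast_eq_zero_of_pderiv_eq_zero h (mem_support_iff.mpr hne) i

theorem exists_pow_eq_of_pderiv_eq_zero [NoZeroDivisors R] (p : ℕ) [Fact p.Prime] [CharP R p]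
    [PerfectRing R p] {P : MvPolynomial σ R} (h : ∀ i, pderiv i P = 0) : ∃ Q, Q ^ p = P := by
  have hdvd : ∀ α ∈ P.support, ∃ β : σ →₀ ℕ, p • β = α := fun α hα =>
    ⟨α.mapRange (· / p) (Nat.zero_div p), Finsupp.ext fun i => by
      simpa using Nat.mul_div_cancel' ((CharP.cast_eq_zero_iff R p _).mp
        (cast_eq_zero_of_pderiv_eq_zero h hα i))⟩
  choose! β hβ using hdvd
  refine ⟨∑ α ∈ P.support, monomial (β α) ((frobeniusEquiv R p).symm (coeff α P)), ?_⟩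
  rw [← map_frobenius_expand p]
  conv_rhs => rw [P.as_sum]
  simp only [map_sum, expand_monomial, map_monomial]
  refine Finset.sum_congr rfl fun α hα => ?_
  rw [hβ α hα]
  exact congrArg _ ((frobeniusEquiv R p).apply_symm_apply _)

theorem exists_pderiv_ne_zero {K : Type*} [Field K] [PerfectField K] {P : MvPolynomial σ K}
    (hP : Irreducible P) : ∃ i, pderiv i P ≠ 0 := by
  by_contra! h
  obtain ⟨p, hp⟩ := CharP.exists K
  rcases CharP.char_is_prime_or_zero K p with hpp | rfl
  · have := Fact.mk hpp
    have := PerfectField.toPerfectRing (K := K) p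
    obtain ⟨Q, rfl⟩ := exists_pow_eq_of_pderiv_eq_zero p h
    exact not_irreducible_pow hpp.ne_one hP
  · have := CharP.charP_to_charZero K
    obtain ⟨c, rfl⟩ := exists_eq_C_of_pderiv_eq_zero h
    have hc : c ≠ 0 := fun hc => hP.ne_zero (by rw [hc, C_0])
    exact hP.not_isUnit ((isUnit_iff_ne_zero.mpr hc).map C)

end MvPolynomials

section Elimination

variable {B : Type*} [CommRing B] [IsDomain B] [UniqueFactorizationMonoid B]
  {p q : Polynomial B}

theorem exists_mul_add_mul_eq_C (hp : Irreducible p) (hdeg : p.natDegree ≠ 0) (hpq : ¬ p ∣ q) :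
    ∃ c ≠ 0, ∃ u w : Polynomial B, u * p + w * q = Polynomial.C c := by
  have hprim : p.IsPrimitive := hp.isPrimitive hdeg
  let E := FractionRing B
  have hcop : IsCoprime (p.map (algebraMap B E)) (q.map (algebraMap B E)) :=
    (hprim.irreducible_iff_irreducible_map_fraction_map.mp hp).coprime_iff_not_dvd.mpr
      fun h => hpq (hprim.dvd_of_fraction_map_dvd_fraction_map h)
  obtain ⟨u, w, huw⟩ := hcop
  obtain ⟨b, hb0, hb⟩ := IsLocalization.integerNormalization_spec (nonZeroDivisors B) u
  obtain ⟨c, hc0, hc⟩ := IsLocalization.integerNormalization_spec (nonZeroDivisors B) w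
  refine ⟨b * c, mul_ne_zero (nonZeroDivisors.ne_zero hb0) (nonZeroDivisors.ne_zero hc0),
    Polynomial.C c * IsLocalization.integerNormalization (nonZeroDivisors B) u,
    Polynomial.C b * IsLocalization.integerNormalization (nonZeroDivisors B) w, ?_⟩
  apply Polynomial.map_injective (algebraMap B E) (IsFractionRing.injective B E)
  simp only [Polynomial.map_add, Polynomial.map_mul, Polynomial.map_C, hb, hc,
    Algebra.smul_def, Polynomial.algebraMap_apply, map_mul]
  linear_combination (Polynomial.C (algebraMap B E b) * Polynomial.C (algebraMap B E c)) * huw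

theorem exists_forall_separable_map (hp : Irreducible p) (hp' : Polynomial.derivative p ≠ 0) :
    ∃ c ≠ 0, ∀ {k : Type*} [Field k] (φ : B →+* k), φ c ≠ 0 → (p.map φ).Separable := by
  have hdeg : p.natDegree ≠ 0 := fun h => hp' (Polynomial.derivative_of_natDegree_zero h)
  obtain ⟨c, hc, u, w, huw⟩ := exists_mul_add_mul_eq_C hp hdeg fun hdvd =>
    (Polynomial.natDegree_derivative_lt hdeg).not_ge (Polynomial.natDegree_le_of_dvd hdvd hp')
  refine ⟨c, hc, fun φ hφ => ?_⟩
  have hφu := congrArg (Polynomial.map φ) huw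
  simp only [Polynomial.map_add, Polynomial.map_mul, Polynomial.map_C,
    ← Polynomial.derivative_map] at hφu
  refine ⟨Polynomial.C (φ c)⁻¹ * u.map φ, Polynomial.C (φ c)⁻¹ * w.map φ, ?_⟩
  rw [mul_assoc, mul_assoc, ← mul_add, hφu, ← Polynomial.C_mul, inv_mul_cancel₀ hφ,
    Polynomial.C_1]

end Elimination

section LyingOver

variable {A R : Type*} [CommRing A] [CommRing R] [Algebra A R] {s : Set R}

theorem isIntegral_localization_of_adjoin_eq_top (M : Submonoid A) (hs : Algebra.adjoin A s = ⊤)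
    (halg : ∀ x ∈ s, ∃ q : Polynomial A, q.leadingCoeff ∈ M ∧ Polynomial.aeval x q = 0)
    (A' R' : Type*) [CommRing A'] [CommRing R'] [Algebra A A'] [Algebra R R'] [Algebra A' R']
    [Algebra A R'] [IsScalarTower A A' R'] [IsScalarTower A R R'] [IsLocalization M A']
    [IsLocalization (Algebra.algebraMapSubmonoid R M) R'] : Algebra.IsIntegral A' R' := by
  have hunit : ∀ u ∈ M, ∀ z : R', IsIntegral A' (algebraMap A R' u * z) → IsIntegral A' z := by
    intro u hu z hz
    obtain ⟨v, hv⟩ := (IsLocalization.map_units A' (⟨u, hu⟩ : M)).exists_left_inv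
    have hvz : algebraMap A' R' v * (algebraMap A R' u * z) = z := by
      rw [← mul_assoc, IsScalarTower.algebraMap_apply A A' R', ← map_mul, hv, map_one, one_mul]
    exact hvz ▸ isIntegral_algebraMap.mul hz
  have hR : ∀ x : R, IsIntegral A' (algebraMap R R' x) := by
    intro x
    have hx : x ∈ Algebra.adjoin A s := hs ▸ Algebra.mem_top
    induction hx using Algebra.adjoin_induction with
    | mem x hx =>
      obtain ⟨q, hq, hqx⟩ := halg x hx
      have hint : IsIntegral A' (algebraMap R R' (q.leadingCoeff • x)) :=
        (isIntegral_leadingCoeff_smul q x hqx).algebraMap.tower_top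
      rw [Algebra.smul_def, map_mul, ← IsScalarTower.algebraMap_apply] at hint
      exact hunit _ hq _ hint
    | algebraMap a =>
      rw [← IsScalarTower.algebraMap_apply, IsScalarTower.algebraMap_apply A A' R']
      exact isIntegral_algebraMap
    | add x y _ _ hx hy => exact map_add (algebraMap R R') x y ▸ hx.add hy
    | mul x y _ _ hx hy => exact map_mul (algebraMap R R') x y ▸ hx.mul hy
  refine ⟨fun x => ?_⟩
  obtain ⟨⟨y, ⟨_, u, hu, rfl⟩⟩, hy⟩ :=
    IsLocalization.surj (Algebra.algebraMapSubmonoid R M) x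
  refine hunit u hu x ?_
  rw [mul_comm, IsScalarTower.algebraMap_apply A R R']
  exact hy ▸ hR y

theorem exists_isPrime_comap_eq_of_leadingCoeff_notMem (𝔮 : Ideal A) [𝔮.IsPrime]
    (hker : RingHom.ker (algebraMap A R) ≤ 𝔮) (hs : Algebra.adjoin A s = ⊤)
    (halg : ∀ x ∈ s, ∃ q : Polynomial A, q.leadingCoeff ∉ 𝔮 ∧ Polynomial.aeval x q = 0) :
    ∃ Q : Ideal R, Q.IsPrime ∧ Q.comap (algebraMap A R) = 𝔮 := by
  let M := 𝔮.primeCompl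
  let A' := Localization.AtPrime 𝔮
  let R' := Localization (Algebra.algebraMapSubmonoid R M)
  let _ : Algebra A' R' := localizationAlgebra M R
  have hcomp : (algebraMap A' R').comp (algebraMap A A') =
      (algebraMap R R').comp (algebraMap A R) := IsLocalization.map_comp _
  have : IsScalarTower A A' R' := .of_algebraMap_eq' hcomp.symm
  have := isIntegral_localization_of_adjoin_eq_top M hs halg A' R'
  have : Nontrivial R' := by
    by_contra h
    rw [not_nontrivial_iff_subsingleton,
      IsLocalization.subsingleton_iff (M := Algebra.algebraMapSubmonoid R M)] at h
    obtain ⟨a, ha, ha0⟩ := h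
    exact ha (hker ha0)
  obtain ⟨Q', -, hQ', hQ'm⟩ := Ideal.exists_ideal_over_prime_of_isIntegral
    (S := R') (IsLocalRing.maximalIdeal A') ⊥ (IsLocalRing.le_maximalIdeal (by
      rw [Ne, Ideal.comap_eq_top_iff]
      exact bot_ne_top))
  refine ⟨Q'.comap (algebraMap R R'), Ideal.IsPrime.comap _, ?_⟩
  rw [Ideal.comap_comap, ← hcomp, ← Ideal.comap_comap, hQ'm]
  exact IsLocalization.AtPrime.under_maximalIdeal A' 𝔮

end LyingOver

section Hypersurfaces

variable {K : Type*} [Field K]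

theorem exists_det_ne_zero_of_linearIndependent {ι X : Type*} [Fintype ι] [DecidableEq ι]
    {f : ι → X → K} (hf : LinearIndependent K f) :
    ∃ x : ι → X, (Matrix.of fun i j => f j (x i)).det ≠ 0 := by
  have hspan : Submodule.span K (Set.range fun x i => f i x) = ⊤ := by
    by_contra hne
    obtain ⟨φ, hφ, hle⟩ := Submodule.exists_le_ker_of_lt_top _ (lt_top_iff_ne_top.mpr hne)
    obtain ⟨c, rfl⟩ := (dotProductEquiv K ι).surjective φ
    refine hφ ((LinearEquiv.map_eq_zero_iff _).mpr (funext ?_))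
    refine Fintype.linearIndependent_iff.mp hf c (funext fun x => ?_)
    simpa [dotProduct] using hle (Submodule.subset_span ⟨x, rfl⟩)
  obtain ⟨v, hv, -, hind⟩ :=
    Submodule.exists_fun_fin_finrank_span_eq K (Set.range fun x i => f i x)
  have e : ι ≃ Fin (Module.finrank K (Submodule.span K (Set.range fun x i => f i x))) :=
    Fintype.equivOfCardEq (by rw [hspan, finrank_top, Module.finrank_fintype_fun_eq_card,
      Fintype.card_fin])
  choose x hx using hv
  refine ⟨fun i => x (e i), ?_⟩
  have hrows : LinearIndependent K (Matrix.of fun i j => f j (x (e i))).row := by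
    have hrow : (Matrix.of fun i j => f j (x (e i))).row = v ∘ e := funext fun i => hx (e i)
    rw [hrow]
    exact hind.comp e e.injective
  exact ((Matrix.isUnit_iff_isUnit_det _).mp
    (Matrix.linearIndependent_rows_iff_isUnit.mp hrows)).ne_zero

theorem linearIndependent_of_det_ne_zero {ι X : Type*} [Fintype ι] [DecidableEq ι]
    {f : ι → X → K} {x : ι → X} (h : (Matrix.of fun i j => f j (x i)).det ≠ 0) :
    LinearIndependent K f :=
  .of_comp (LinearMap.funLeft K K x) (Matrix.linearIndependent_cols_of_det_ne_zero h)

theorem exists_forall_linearIndependent_eval {ι X σ : Type*} [Finite ι]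
    {f : ι → X → MvPolynomial σ K} {a₀ : σ → K}
    (h : LinearIndependent K fun i x => eval a₀ (f i x)) :
    ∃ Δ : MvPolynomial σ K, eval a₀ Δ ≠ 0 ∧
      ∀ a, eval a Δ ≠ 0 → LinearIndependent K fun i x => eval a (f i x) := by
  classical
  have := Fintype.ofFinite ι
  obtain ⟨x, hx⟩ := exists_det_ne_zero_of_linearIndependent h
  have heval : ∀ a, eval a (Matrix.of fun i j => f j (x i)).det =
      (Matrix.of fun i j => eval a (f j (x i))).det := fun a => RingHom.map_det _ _
  refine ⟨(Matrix.of fun i j => f j (x i)).det, heval a₀ ▸ hx, fun a ha => ?_⟩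
  exact linearIndependent_of_det_ne_zero (heval a ▸ ha)

theorem linearIndependent_comp_basis_iff {ι M N : Type*} [AddCommGroup M] [Module K M]
    [AddCommGroup N] [Module K N] (b : Module.Basis ι K M) (φ : M →ₗ[K] N) :
    LinearIndependent K (φ ∘ b) ↔ LinearMap.ker φ = ⊥ := by
  refine ⟨fun h => ?_, b.linearIndependent.map' φ⟩
  rw [LinearMap.ker_eq_bot, ← b.constr_self K φ]
  exact b.injective_constr_of_linearIndependent h

variable {σ τ : Type*} {N : ℕ}

/-- The set `S` of points of an affine space is contained in a hypersurface of degree at most `N`,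
that is, some nonzero polynomial of degree at most `N` vanishes on `S`. -/
def LiesOnHypersurface (N : ℕ) (S : Set (σ → K)) : Prop :=
  ∃ P ∈ vanishingIdeal K S, P ≠ 0 ∧ P.totalDegree ≤ N

theorem LiesOnHypersurface.mono {N' : ℕ} {S T : Set (σ → K)} (h : LiesOnHypersurface N T)
    (hN : N ≤ N') (hST : S ⊆ T) : LiesOnHypersurface N' S :=
  let ⟨P, hPT, hP0, hPN⟩ := h
  ⟨P, vanishingIdeal_anti_mono hST hPT, hP0, hPN.trans hN⟩

theorem LiesOnHypersurface.of_image_comp {f : σ → τ} (hf : Function.Injective f)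
    {S : Set (τ → K)} (h : LiesOnHypersurface N ((· ∘ f) '' S)) : LiesOnHypersurface N S := by
  obtain ⟨P, hPS, hP0, hPN⟩ := h
  refine ⟨rename f P, fun x hx => ?_, ?_, (totalDegree_rename_le f P).trans hPN⟩
  · rw [aeval_rename]
    exact hPS _ ⟨x, hx, rfl⟩
  · rwa [Ne, map_eq_zero_iff _ (rename_injective f hf)]

theorem LiesOnHypersurface.biUnion {ι : Type*} {s : Finset ι} {N : ι → ℕ} {S : ι → Set (σ → K)}
    (h : ∀ i ∈ s, LiesOnHypersurface (N i) (S i)) :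
    LiesOnHypersurface (∑ i ∈ s, N i) (⋃ i ∈ s, S i) := by
  choose! P hPS hP0 hPN using h
  refine ⟨∏ i ∈ s, P i, fun x hx => ?_, Finset.prod_ne_zero_iff.mpr hP0,
    (totalDegree_finsetProd _ _).trans (Finset.sum_le_sum hPN)⟩
  obtain ⟨i, hi, hx⟩ := Set.mem_iUnion₂.mp hx
  rw [map_prod]
  exact Finset.prod_eq_zero hi (hPS i hi x hx)

/-- Evaluation of the polynomials of degree at most `N` at the points of a family. The kernel
consists of the equations of degree at most `N` of these points. -/
noncomputable def evalFamily {X : Type*} (N : ℕ) (y : X → σ → K) :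
    restrictTotalDegree σ K N →ₗ[K] (X → K) :=
  LinearMap.pi fun x => (aeval (R := K) (y x)).toLinearMap ∘ₗ Submodule.subtype _

theorem evalFamily_apply {X : Type*} (y : X → σ → K) (P : restrictTotalDegree σ K N) (x : X) :
    evalFamily N y P x = aeval (y x) P.1 := rfl

theorem liesOnHypersurface_range_iff {X : Type*} {y : X → σ → K} :
    LiesOnHypersurface N (Set.range y) ↔ LinearMap.ker (evalFamily N y) ≠ ⊥ := by
  rw [Submodule.ne_bot_iff]
  constructor
  · rintro ⟨P, hPy, hP0, hPN⟩
    refine ⟨⟨P, (mem_restrictTotalDegree _ _ _).mpr hPN⟩,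
      LinearMap.mem_ker.mpr (funext fun x => ?_), fun h => hP0 (congrArg Subtype.val h)⟩
    rw [evalFamily_apply]
    exact hPy _ ⟨x, rfl⟩
  · rintro ⟨P, hPy, hP0⟩
    refine ⟨P, ?_, fun h => hP0 (Subtype.ext h), (mem_restrictTotalDegree _ _ _).mp P.2⟩
    rintro _ ⟨x, rfl⟩
    rw [← evalFamily_apply, LinearMap.mem_ker.mp hPy, Pi.zero_apply]

theorem liesOnHypersurface_of_generic [Infinite K] [Finite σ] {X : Type*}
    (y : X → σ → MvPolynomial τ K) {H : MvPolynomial τ K} (hH : H ≠ 0)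
    (h : ∀ a, eval a H ≠ 0 → LiesOnHypersurface N (Set.range fun x i => eval a (y x i)))
    (a₀ : τ → K) : LiesOnHypersurface N (Set.range fun x i => eval a₀ (y x i)) := by
  let b := Module.finBasis K (restrictTotalDegree σ K N)
  let f (i) (x : X) : MvPolynomial τ K := aeval (y x) (b i).1
  have hf (a : τ → K) :
      (fun i x => eval a (f i x)) = evalFamily N (fun x i => eval a (y x i)) ∘ b :=
    funext₂ fun i x => comp_aeval_apply (y x) (aeval a : MvPolynomial τ K →ₐ[K] K) (b i).1
  by_contra ha₀
  rw [liesOnHypersurface_range_iff, not_not, ← linearIndependent_comp_basis_iff b, ← hf] at ha₀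
  obtain ⟨Δ, hΔ₀, hΔ⟩ := exists_forall_linearIndependent_eval ha₀
  obtain ⟨a, ha⟩ := exists_eval_ne_zero
    (mul_ne_zero hH fun h0 : Δ = 0 => hΔ₀ (by rw [h0, map_zero]))
  rw [map_mul] at ha
  have hrel := liesOnHypersurface_range_iff.mp (h a (left_ne_zero_of_mul ha))
  rw [Ne, ← linearIndependent_comp_basis_iff b, ← hf] at hrel
  exact hrel (hΔ a (right_ne_zero_of_mul ha))

end Hypersurfaces

section Shear

variable {K : Type*} [Field K] {r : ℕ}

/-- The linear change of variables `X₀ ↦ X₀`, `Xᵢ ↦ Xᵢ + vᵢ X₀` for `i ≥ 1`, which turns the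
direction `(1, v)` into that of the variable `X₀`. -/
noncomputable def shearEquiv (v : Fin r → K) :
    MvPolynomial (Fin (r + 1)) K ≃ₐ[K] MvPolynomial (Fin (r + 1)) K :=
  AlgEquiv.ofAlgHom (aeval (Fin.cons (X 0) fun i => X i.succ + C (v i) * X 0))
    (aeval (Fin.cons (X 0) fun i => X i.succ - C (v i) * X 0))
    (algHom_ext fun i => by cases i using Fin.cases <;> simp [algHom_C])
    (algHom_ext fun i => by cases i using Fin.cases <;> simp [algHom_C])

theorem shearEquiv_apply (v : Fin r → K) (P : MvPolynomial (Fin (r + 1)) K) :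
    shearEquiv v P = aeval (Fin.cons (X 0) fun i => X i.succ + C (v i) * X 0) P := rfl

theorem eval_shearEquiv (v : Fin r → K) (z : K) (b : Fin r → K)
    (P : MvPolynomial (Fin (r + 1)) K) :
    eval (Fin.cons z b : Fin (r + 1) → K) (shearEquiv v P) =
      eval (Fin.cons z fun i => b i + v i * z : Fin (r + 1) → K) P := by
  simp only [← coe_aeval_eq_eval, RingHom.coe_coe, shearEquiv_apply, comp_aeval_apply]
  congr 2
  funext i
  cases i using Fin.cases <;> simp

theorem totalDegree_shearEquiv_le (v : Fin r → K) (P : MvPolynomial (Fin (r + 1)) K) :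
    (shearEquiv v P).totalDegree ≤ P.totalDegree := by
  refine totalDegree_aeval_le_of_totalDegree_le_one (fun i => ?_) P
  cases i using Fin.cases with
  | zero => simp
  | succ i =>
    refine (totalDegree_add _ _).trans (max_le (by simp) ((totalDegree_mul _ _).trans ?_))
    simp

theorem map_eval_finSuccEquiv_shearEquiv (v b : Fin r → K) (P : MvPolynomial (Fin (r + 1)) K) :
    (finSuccEquiv K r (shearEquiv v P)).map (eval b) =
      aeval (Fin.cons Polynomial.X fun i => Polynomial.C (b i) + Polynomial.C (v i) * Polynomial.X :
        Fin (r + 1) → Polynomial K) P := by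
  change Polynomial.mapAlgHom (aeval b : MvPolynomial (Fin r) K →ₐ[K] K)
    ((finSuccEquiv K r).toAlgHom (shearEquiv v P)) = _
  rw [shearEquiv_apply, comp_aeval_apply, comp_aeval_apply]
  congr 2
  funext i
  cases i using Fin.cases <;> simp [finSuccEquiv_apply]

theorem homogeneousComponent_totalDegree_ne_zero {σ R : Type*} [CommSemiring R]
    {P : MvPolynomial σ R} (hP : P ≠ 0) : homogeneousComponent P.totalDegree P ≠ 0 := by
  obtain ⟨α, hα, hαe⟩ := Finset.exists_mem_eq_sup P.support (support_nonempty.mpr hP)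
    fun s : σ →₀ ℕ => s.sum fun _ e => e
  refine ne_zero_iff.mpr ⟨α, ?_⟩
  rw [coeff_homogeneousComponent, if_pos]
  · exact mem_support_iff.mp hα
  · exact hαe.symm

theorem eval_smul_of_isHomogeneous {σ R : Type*} [CommSemiring R] {p : MvPolynomial σ R} {e : ℕ}
    (hp : p.IsHomogeneous e) (c : R) (w : σ → R) : eval (c • w) p = c ^ e * eval w p := by
  rw [eval_eq, eval_eq, Finset.mul_sum]
  refine Finset.sum_congr rfl fun α hα => ?_
  have hdeg : ∑ i ∈ α.support, α i = e := by
    rw [← hp (mem_support_iff.mp hα)]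
    exact DFunLike.congr_fun Finsupp.degree_eq_weight_one α
  simp only [Pi.smul_apply, smul_eq_mul, mul_pow, Finset.prod_mul_distrib]
  rw [Finset.prod_pow_eq_pow_sum, hdeg, mul_left_comm]

theorem exists_eval_cons_one_ne_zero [Infinite K] {Q : MvPolynomial (Fin (r + 1)) K} {e : ℕ}
    (hQ : Q.IsHomogeneous e) (hQ0 : Q ≠ 0) :
    ∃ v : Fin r → K, eval (Fin.cons 1 v : Fin (r + 1) → K) Q ≠ 0 := by
  obtain ⟨w, hw⟩ := exists_eval_ne_zero (mul_ne_zero hQ0 (X_ne_zero (0 : Fin (r + 1))))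
  rw [map_mul, eval_X] at hw
  have hw0 : w 0 ≠ 0 := right_ne_zero_of_mul hw
  have hsmul : w = w 0 • (Fin.cons 1 fun i => (w 0)⁻¹ * w i.succ : Fin (r + 1) → K) := by
    funext i
    cases i using Fin.cases <;> simp [hw0]
  refine ⟨fun i => (w 0)⁻¹ * w i.succ, fun h0 => left_ne_zero_of_mul hw ?_⟩
  rw [hsmul, eval_smul_of_isHomogeneous hQ, h0, mul_zero]

theorem exists_forall_natDegree_shearEquiv [Infinite K] {P : MvPolynomial (Fin (r + 1)) K}
    (hP : P ≠ 0) : ∃ q : MvPolynomial (Fin r) K, q ≠ 0 ∧ ∀ v, eval v q ≠ 0 →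
      (finSuccEquiv K r (shearEquiv v P)).natDegree = P.totalDegree := by
  -- The coefficient of `X₀ ^ deg P` in the sheared polynomial is the value of the leading form
  -- of `P` at `(1, v)`.
  let q : MvPolynomial (Fin r) K :=
    aeval (Fin.cons 1 X) (homogeneousComponent P.totalDegree P)
  have hq (v) : eval v q = eval (Fin.cons 1 v : Fin (r + 1) → K)
      (homogeneousComponent P.totalDegree P) := by
    simp only [q, ← coe_aeval_eq_eval, RingHom.coe_coe, comp_aeval_apply]
    congr 2
    funext i
    cases i using Fin.cases <;> simp
  obtain ⟨v₀, hv₀⟩ := exists_eval_cons_one_ne_zero (homogeneousComponent_isHomogeneous _ P)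
    (homogeneousComponent_totalDegree_ne_zero hP)
  refine ⟨q, fun h0 => hv₀ (by rw [← hq, h0, map_zero]), fun v hv => le_antisymm ?_ ?_⟩
  · rw [natDegree_finSuccEquiv]
    exact (degreeOf_le_totalDegree _ _).trans (totalDegree_shearEquiv_le v P)
  · refine Polynomial.le_natDegree_of_ne_zero fun h0 => hv ?_
    have hline : (Fin.cons Polynomial.X fun i => Polynomial.C ((0 : Fin r → K) i) +
        Polynomial.C (v i) * Polynomial.X : Fin (r + 1) → Polynomial K) =
        fun i => Polynomial.C ((Fin.cons 1 v : Fin (r + 1) → K) i) * Polynomial.X := by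
      funext i
      cases i using Fin.cases <;> simp
    rw [hq, ← coeff_aeval_C_mul_X, ← hline, ← map_eval_finSuccEquiv_shearEquiv,
      Polynomial.coeff_map, h0, map_zero]

theorem eval_derivative_finSuccEquiv_shearEquiv (v : Fin r → K) (a : Fin (r + 1) → K)
    (P : MvPolynomial (Fin (r + 1)) K) :
    ((Polynomial.derivative (finSuccEquiv K r (shearEquiv v P))).map
        (eval fun i => a i.succ - v i * a 0)).eval (a 0) =
      eval a (pderiv 0 P) + ∑ i, eval a (pderiv i.succ P) * v i := by
  have heval (Q : MvPolynomial (Fin (r + 1)) K) : Polynomial.eval (a 0) (aeval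
      (Fin.cons Polynomial.X fun i => Polynomial.C (a i.succ - v i * a 0) +
        Polynomial.C (v i) * Polynomial.X : Fin (r + 1) → Polynomial K) Q) = eval a Q := by
    simp only [← Polynomial.coe_aeval_eq_eval, ← coe_aeval_eq_eval, RingHom.coe_coe,
      comp_aeval_apply]
    congr 2
    funext i
    cases i using Fin.cases <;> simp
  rw [← Polynomial.derivative_map, map_eval_finSuccEquiv_shearEquiv, derivative_aeval,
    Polynomial.eval_finsetSum, Fin.sum_univ_succ]
  simp only [Polynomial.eval_mul, heval]
  simp

theorem exists_forall_derivative_shearEquiv_ne_zero [Infinite K]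
    {P : MvPolynomial (Fin (r + 1)) K} (hP : ∃ i, pderiv i P ≠ 0) :
    ∃ q : MvPolynomial (Fin r) K, q ≠ 0 ∧ ∀ v, eval v q ≠ 0 →
      Polynomial.derivative (finSuccEquiv K r (shearEquiv v P)) ≠ 0 := by
  obtain ⟨i₀, hi₀⟩ := hP
  obtain ⟨a, ha⟩ := exists_eval_ne_zero hi₀
  let q : MvPolynomial (Fin r) K :=
    C (eval a (pderiv 0 P)) + ∑ i : Fin r, C (eval a (pderiv i.succ P)) * X i
  have hq (v) : eval v q = eval a (pderiv 0 P) + ∑ i : Fin r, eval a (pderiv i.succ P) * v i := by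
    simp [q]
  refine ⟨q, fun h0 => ha ?_, fun v hv hder => hv ?_⟩
  · have hzero (v) := (hq v).symm.trans (by rw [h0, map_zero])
    have h0 : eval a (pderiv 0 P) = 0 := by simpa using hzero 0
    cases i₀ using Fin.cases with
    | zero => exact h0
    | succ i => simpa [h0, Pi.single_apply] using hzero (Pi.single i 1)
  · rw [hq, ← eval_derivative_finSuccEquiv_shearEquiv, hder, Polynomial.map_zero,
      Polynomial.eval_zero]

end Shear

section PolynomialMaps

variable {F K : Type*} [Field F] [Field K] [Algebra F K] {n m : ℕ} {W : Set (Fin n → K)}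

theorem vanishingIdeal_image_polyMap (f : Fin m → MvPolynomial (Fin n) F) :
    vanishingIdeal F (polyMap K f '' W) = (vanishingIdeal F W).comap (aeval f) := by
  ext p
  simp only [mem_vanishingIdeal_iff, Set.forall_mem_image, Ideal.mem_comap, aeval_polyMap]

theorem algebraicIndependent_mk_iff {f : Fin m → MvPolynomial (Fin n) F} :
    AlgebraicIndependent F (fun i => (Ideal.Quotient.mk (vanishingIdeal F W) (f i))) ↔
      vanishingIdeal F (polyMap K f '' W) = ⊥ := by
  rw [vanishingIdeal_image_polyMap, algebraicIndependent_iff, eq_bot_iff]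
  refine forall_congr' fun p => ?_
  rw [Ideal.mem_comap, ← Ideal.Quotient.eq_zero_iff_mem, Ideal.mem_bot,
    ← Ideal.Quotient.mkₐ_eq_mk F, comp_aeval_apply]

theorem adjoin_range_mk_X (R : Type*) {σ : Type*} [CommRing R] (I : Ideal (MvPolynomial σ R)) :
    Algebra.adjoin R (Set.range fun i => Ideal.Quotient.mk I (X i)) = ⊤ := by
  have hrange : (Set.range fun i => Ideal.Quotient.mk I (X i)) =
      Ideal.Quotient.mkₐ R I '' Set.range X := by
    rw [← Set.range_comp]
    rfl
  rw [hrange, ← AlgHom.map_adjoin, adjoin_range_X, Algebra.map_top, AlgHom.range_eq_top]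
  exact Ideal.Quotient.mkₐ_surjective R I

theorem adjoin_eq_top_of_isScalarTower (R : Type*) {A B : Type*} [CommSemiring R] [CommSemiring A]
    [Semiring B] [Algebra R A] [Algebra R B] [Algebra A B] [IsScalarTower R A B] {s : Set B}
    (h : Algebra.adjoin R s = ⊤) : Algebra.adjoin A s = ⊤ := by
  have hle : Algebra.adjoin R s ≤ (Algebra.adjoin A s).restrictScalars R :=
    Algebra.adjoin_le Algebra.subset_adjoin
  exact eq_top_iff.mpr fun _ _ => hle (h ▸ Algebra.mem_top)

theorem mem_image_polyMap_of_ne_top [IsAlgClosed K] (hW : IsAffineVariety K W)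
    {f : Fin m → MvPolynomial (Fin n) K} {a : Fin m → K} {Q : Ideal (CoordinateRing K W)}
    (hQ : Q ≠ ⊤) (h : ∀ p ∈ vanishingIdeal K {a}, Ideal.Quotient.mk _ (aeval f p) ∈ Q) :
    a ∈ polyMap K f '' W := by
  obtain ⟨M, hM, hQM⟩ := Ideal.exists_le_maximal Q hQ
  obtain ⟨x, hx⟩ := eq_vanishingIdeal_singleton_of_isMaximal K
    (Ideal.comap_isMaximal_of_surjective _ Ideal.Quotient.mk_surjective (K := M))
  refine ⟨x, hW.subset_of_vanishingIdeal_le (W := {x}) (fun p hp => ?_) rfl, funext fun i => ?_⟩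
  · rw [← hx, Ideal.mem_comap, Ideal.Quotient.eq_zero_iff_mem.mpr hp]
    exact zero_mem M
  · have hi : aeval f (X i - C (a i)) ∈ vanishingIdeal K {x} :=
      hx ▸ hQM (h _ (by simp))
    rw [mem_vanishingIdeal_singleton_iff, ← aeval_polyMap] at hi
    simpa [sub_eq_zero] using hi

theorem eval₂_mk_X_eq_zero {f : Fin m → MvPolynomial (Fin n) K} {j : Fin n}
    {q : Polynomial (MvPolynomial (Fin m) K)}
    (hq : ∀ x ∈ W, (q.map (eval (polyMap K f x))).eval (x j) = 0) :
    q.eval₂ ((Ideal.Quotient.mk (vanishingIdeal K W)).comp (aeval (R := K) f).toRingHom)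
      (Ideal.Quotient.mk (vanishingIdeal K W) (X j)) = 0 := by
  rw [← Polynomial.hom_eval₂, Ideal.Quotient.eq_zero_iff_mem]
  intro x hx
  rw [← hq x hx, Polynomial.eval_map, ← RingHom.coe_coe, Polynomial.hom_eval₂, RingHom.coe_coe,
    aeval_X]
  congr 1
  exact RingHom.ext fun p => (aeval_polyMap f x p).symm

theorem mem_image_polyMap_of_isAlgebraic [IsAlgClosed K] (hW : IsAffineVariety K W)
    {f : Fin m → MvPolynomial (Fin n) K} {a : Fin m → K}
    (ha : vanishingIdeal K (polyMap K f '' W) ≤ vanishingIdeal K {a})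
    (halg : ∀ j, ∃ q : Polynomial (MvPolynomial (Fin m) K), eval a q.leadingCoeff ≠ 0 ∧
      ∀ x ∈ W, (q.map (eval (polyMap K f x))).eval (x j) = 0) :
    a ∈ polyMap K f '' W := by
  let φ : MvPolynomial (Fin m) K →+* CoordinateRing K W :=
    (Ideal.Quotient.mk _).comp (aeval (R := K) f).toRingHom
  algebraize [φ]
  have : IsScalarTower K (MvPolynomial (Fin m) K) (CoordinateRing K W) :=
    .of_algHom ((Ideal.Quotient.mkₐ K (vanishingIdeal K W)).comp (aeval f))
  have hadjoin := adjoin_eq_top_of_isScalarTower K (A := MvPolynomial (Fin m) K)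
    (adjoin_range_mk_X K (vanishingIdeal K W))
  obtain ⟨Q, hQ, hQa⟩ := exists_isPrime_comap_eq_of_leadingCoeff_notMem (vanishingIdeal K {a})
    (fun q hq => ha <| by
      rw [vanishingIdeal_image_polyMap, Ideal.mem_comap, ← Ideal.Quotient.eq_zero_iff_mem]
      exact hq)
    hadjoin (by
      rintro _ ⟨j, rfl⟩
      obtain ⟨q, hqa, hq⟩ := halg j
      exact ⟨q, fun h => hqa (h a rfl), eval₂_mk_X_eq_zero hq⟩)
  exact mem_image_polyMap_of_ne_top hW hQ.ne_top fun p hp => hQa.ge hp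

end PolynomialMaps

section Fibres

variable {K : Type*} [Field K] {n r : ℕ}

theorem vanishingIdeal_eq_bot_of_forall_mem [Infinite K] {σ : Type*} {S : Set (σ → K)}
    {g : MvPolynomial σ K} (hg : g ≠ 0) (h : ∀ b, eval b g ≠ 0 → b ∈ S) :
    vanishingIdeal K S = ⊥ := by
  refine eq_bot_iff.mpr fun p hp => ?_
  by_contra hp0
  obtain ⟨b, hb⟩ := exists_eval_ne_zero (mul_ne_zero hg hp0)
  rw [map_mul] at hb
  exact right_ne_zero_of_mul hb (hp b (h b (left_ne_zero_of_mul hb)))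

theorem vanishingIdeal_eq_span_singleton {S : Set (Fin (r + 1) → K)}
    (hS : vanishingIdeal K (Fin.tail '' S) = ⊥) {P : MvPolynomial (Fin (r + 1)) K}
    (hP : Irreducible P) (hPS : P ∈ vanishingIdeal K S)
    (hdeg : (finSuccEquiv K r P).natDegree ≠ 0) : vanishingIdeal K S = Ideal.span {P} := by
  refine le_antisymm (fun Q hQ => ?_) ((Ideal.span_singleton_le_iff_mem _).mpr hPS)
  rw [Ideal.mem_span_singleton, ← map_dvd_iff (finSuccEquiv K r)]
  by_contra hdvd
  obtain ⟨c, hc, u, w, huw⟩ := exists_mul_add_mul_eq_C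
    ((MulEquiv.irreducible_iff (finSuccEquiv K r)).mpr hP) hdeg hdvd
  refine hc (hS.le (?_ : c ∈ _))
  rintro _ ⟨a, ha, rfl⟩
  have hval (R) (hR : R ∈ vanishingIdeal K S) :
      ((finSuccEquiv K r R).map (eval (Fin.tail a))).eval (a 0) = 0 := by
    rw [← eval_eq_eval_mv_eval', Fin.cons_self_tail]
    exact hR a ha
  have heval := congrArg (fun p => (p.map (eval (Fin.tail a))).eval (a 0)) huw
  simp only [Polynomial.map_add, Polynomial.map_mul, Polynomial.eval_add, Polynomial.eval_mul,
    hval P hPS, hval Q hQ, Polynomial.map_C, Polynomial.eval_C, mul_zero, add_zero] at heval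
  exact heval.symm

theorem polyMap_cons (f : MvPolynomial (Fin n) K) (g : Fin r → MvPolynomial (Fin n) K)
    (x : Fin n → K) : polyMap K (Fin.cons f g : Fin (r + 1) → MvPolynomial (Fin n) K) x =
      Fin.cons (eval x f) (polyMap K g x) := by
  funext i
  cases i using Fin.cases <;> rfl

variable [IsAlgClosed K] {W : Set (Fin n → K)} {f : MvPolynomial (Fin n) K}
  {g : Fin r → MvPolynomial (Fin n) K} {P : MvPolynomial (Fin (r + 1)) K}

theorem exists_forall_cons_mem_image_polyMap (hW : IsAffineVariety K W)
    (hg : vanishingIdeal K (polyMap K g '' W) = ⊥)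
    (halg : ∀ j, vanishingIdeal K
      (polyMap K (Fin.cons (X j) g : Fin (r + 1) → MvPolynomial (Fin n) K) '' W) ≠ ⊥)
    (hP : Irreducible P) (hPW : P ∈ vanishingIdeal K (polyMap K (Fin.cons f g) '' W))
    (hdeg : (finSuccEquiv K r P).natDegree ≠ 0) :
    ∃ c : MvPolynomial (Fin r) K, c ≠ 0 ∧ ∀ b z, eval b c ≠ 0 →
      eval (Fin.cons z b : Fin (r + 1) → K) P = 0 →
      (Fin.cons z b : Fin (r + 1) → K) ∈ polyMap K (Fin.cons f g) '' W := by
  have htail : Fin.tail '' (polyMap K (Fin.cons f g : Fin (r + 1) → _) '' W) =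
      polyMap K g '' W := by
    simp only [Set.image_image, polyMap_cons, Fin.tail_cons]
  choose T hT hT0 using fun j => (Submodule.ne_bot_iff _).mp (halg j)
  refine ⟨∏ j, (finSuccEquiv K r (T j)).leadingCoeff, ?_, fun b z hb hz => ?_⟩
  · simpa [Finset.prod_ne_zero_iff] using hT0
  refine mem_image_polyMap_of_isAlgebraic hW ?_ fun j => ?_
  · rw [vanishingIdeal_eq_span_singleton (htail ▸ hg) hP hPW hdeg, Ideal.span_singleton_le_iff_mem]
    rintro _ rfl
    exact hz
  · refine ⟨(finSuccEquiv K r (T j)).map (rename Fin.succ).toRingHom, ?_, fun x hx => ?_⟩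
    · rw [map_prod, Finset.prod_ne_zero_iff] at hb
      rw [Polynomial.leadingCoeff_map_of_injective (rename_injective _ (Fin.succ_injective r))]
      simpa [eval_rename, Function.comp_def] using hb j (Finset.mem_univ j)
    · have hTx := hT j _ ⟨x, hx, rfl⟩
      rw [aeval_eq_eval, polyMap_cons, eval_X, eval_eq_eval_mv_eval'] at hTx
      rw [← hTx, polyMap_cons, Polynomial.map_map]
      congr 2
      exact RingHom.ext fun s => by simp [eval_rename, Function.comp_def]

theorem exists_forall_natDegree_le_encard (hW : IsAffineVariety K W)
    (hg : vanishingIdeal K (polyMap K g '' W) = ⊥)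
    (halg : ∀ j, vanishingIdeal K
      (polyMap K (Fin.cons (X j) g : Fin (r + 1) → MvPolynomial (Fin n) K) '' W) ≠ ⊥)
    (hP : Irreducible P) (hPW : P ∈ vanishingIdeal K (polyMap K (Fin.cons f g) '' W))
    (hder : Polynomial.derivative (finSuccEquiv K r P) ≠ 0) :
    ∃ c : MvPolynomial (Fin r) K, c ≠ 0 ∧ ∀ b, eval b c ≠ 0 →
      (finSuccEquiv K r P).natDegree ≤ (W ∩ {x | polyMap K g x = b}).encard := by
  classical
  set p := finSuccEquiv K r P with hp
  have hpirr : Irreducible p := (MulEquiv.irreducible_iff (finSuccEquiv K r)).mpr hP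
  have hdeg : p.natDegree ≠ 0 := fun h => hder (Polynomial.derivative_of_natDegree_zero h)
  obtain ⟨c₁, hc₁, hlift⟩ := exists_forall_cons_mem_image_polyMap hW hg halg hP hPW hdeg
  obtain ⟨c₂, hc₂, hsep⟩ := exists_forall_separable_map hpirr hder
  refine ⟨c₁ * c₂ * p.leadingCoeff, mul_ne_zero (mul_ne_zero hc₁ hc₂)
    (Polynomial.leadingCoeff_ne_zero.mpr hpirr.ne_zero), fun b hb => ?_⟩
  simp only [map_mul, mul_ne_zero_iff] at hb
  obtain ⟨⟨hb₁, hb₂⟩, hlead⟩ := hb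
  have hcard : (p.map (eval b)).roots.toFinset.card = p.natDegree := by
    rw [Multiset.toFinset_card_of_nodup (Polynomial.nodup_roots (hsep _ hb₂)),
      IsAlgClosed.card_roots_eq_natDegree, Polynomial.natDegree_map_of_leadingCoeff_ne_zero _ hlead]
  have hroots : ((p.map (eval b)).roots.toFinset : Set K) ⊆
      (eval · f) '' (W ∩ {x | polyMap K g x = b}) := by
    intro z hz
    have hz0 := (Polynomial.isRoot_of_mem_roots (Multiset.mem_toFinset.mp hz)).eq_zero
    rw [hp, ← eval_eq_eval_mv_eval'] at hz0
    obtain ⟨x, hxW, hx⟩ := hlift b z hb₁ hz0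
    rw [polyMap_cons, Fin.cons_inj] at hx
    exact ⟨x, ⟨hxW, hx.2⟩, hx.1⟩
  calc (p.natDegree : ℕ∞)
      = ((p.map (eval b)).roots.toFinset : Set K).encard := by
        rw [Set.encard_coe_eq_coe_finsetCard, hcard]
    _ ≤ ((eval · f) '' (W ∩ {x | polyMap K g x = b})).encard := Set.encard_le_encard hroots
    _ ≤ (W ∩ {x | polyMap K g x = b}).encard := Set.encard_image_le _ _

theorem natDegree_le_of_forall_encard_eq (hW : IsAffineVariety K W) {G : MvPolynomial (Fin r) K}
    (hG : G ≠ 0) {δ : ℕ} (hδ : δ ≠ 0)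
    (hGδ : ∀ b, eval b G ≠ 0 → (W ∩ {x | polyMap K g x = b}).encard = δ)
    (halg : ∀ j, vanishingIdeal K
      (polyMap K (Fin.cons (X j) g : Fin (r + 1) → MvPolynomial (Fin n) K) '' W) ≠ ⊥)
    (hP : Irreducible P) (hPW : P ∈ vanishingIdeal K (polyMap K (Fin.cons f g) '' W))
    (hder : Polynomial.derivative (finSuccEquiv K r P) ≠ 0) :
    (finSuccEquiv K r P).natDegree ≤ δ := by
  have hg : vanishingIdeal K (polyMap K g '' W) = ⊥ :=
    vanishingIdeal_eq_bot_of_forall_mem hG fun b hb => by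
      have hne : (W ∩ {x | polyMap K g x = b}).Nonempty := by
        rw [← Set.encard_ne_zero, hGδ b hb]
        exact_mod_cast hδ
      exact hne
  obtain ⟨c, hc, hle⟩ := exists_forall_natDegree_le_encard hW hg halg hP hPW hder
  obtain ⟨b, hb⟩ := exists_eval_ne_zero (mul_ne_zero hc hG)
  rw [map_mul] at hb
  have hleδ := (hle b (left_ne_zero_of_mul hb)).trans_eq (hGδ b (right_ne_zero_of_mul hb))
  exact_mod_cast hleδ

end Fibres

section LinearSections

variable {K : Type*} [Field K] {ι κ ρ : Type*}

/-- The value of a polynomial `G` in the coefficients of a linear system at the system `A x = b`,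
whose coefficients may lie in any `K`-algebra. This allows the coefficients to be polynomials. -/
noncomputable def evalSystem {R : Type*} [CommSemiring R] [Algebra K R] (A : Matrix ι κ R)
    (b : ι → R) (G : MvPolynomial ((ι × κ) ⊕ ι) K) : R :=
  aeval (Sum.elim (fun ij => A ij.1 ij.2) b) G

theorem eval_evalSystem {τ : Type*} (A : Matrix ι κ (MvPolynomial τ K))
    (b : ι → MvPolynomial τ K) (G : MvPolynomial ((ι × κ) ⊕ ι) K) (a : τ → K) :
    eval a (evalSystem A b G) = evalSystem (A.map (eval a)) (fun i => eval a (b i)) G := by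
  rw [evalSystem, evalSystem, ← aeval_eq_eval, comp_aeval_apply]
  congr 2
  funext i
  cases i <;> rfl

theorem eval_evalSystem_map_C (A : Matrix ι κ K) (b : ι → K) (G : MvPolynomial ((ι × κ) ⊕ ι) K) :
    eval b (evalSystem (A.map C) X G) = evalSystem A b G := by
  rw [eval_evalSystem]
  congr 1
  · ext i j
    exact eval_C _
  · funext i
    exact eval_X _

theorem exists_evalSystem_ne_zero [Infinite K] {G : MvPolynomial ((ι × κ) ⊕ ι) K} (hG : G ≠ 0) :
    ∃ (A : Matrix ι κ K) (b : ι → K), evalSystem A b G ≠ 0 := by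
  obtain ⟨a, ha⟩ := exists_eval_ne_zero hG
  refine ⟨fun i j => a (Sum.inl (i, j)), fun i => a (Sum.inr i), ?_⟩
  change eval (Sum.elim (a ∘ Sum.inl) (a ∘ Sum.inr)) G ≠ 0
  rwa [Sum.elim_comp_inl_inr]

theorem liesOnHypersurface_image_mulVec_of_generic [Infinite K] [Fintype κ] [Finite ρ]
    {W : Set (κ → K)} {N : ℕ} (s : ι → ρ) {G : MvPolynomial ((ι × κ) ⊕ ι) K} {b : ι → K}
    {A₁ : Matrix ρ κ K} (hA₁ : evalSystem (A₁.submatrix s id) b G ≠ 0)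
    (h : ∀ A : Matrix ρ κ K, evalSystem (A.submatrix s id) b G ≠ 0 →
      LiesOnHypersurface N (A.mulVec '' W)) (A₀ : Matrix ρ κ K) :
    LiesOnHypersurface N (A₀.mulVec '' W) := by
  let H : MvPolynomial (ρ × κ) K :=
    evalSystem (Matrix.of fun i j => X (s i, j)) (fun i => C (b i)) G
  have hH (a : ρ × κ → K) : eval a H = evalSystem (Matrix.of fun i j => a (s i, j)) b G := by
    rw [eval_evalSystem]
    congr 1
    · ext i j
      exact eval_X _
    · funext i
      exact eval_C _
  let y (x : W) (i : ρ) : MvPolynomial (ρ × κ) K := ∑ j, X (i, j) * C (x.1 j)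
  have hy (a : ρ × κ → K) : Set.range (fun x i => eval a (y x i)) =
      (Matrix.of fun i j => a (i, j)).mulVec '' W := by
    rw [Set.image_eq_range]
    congr 1
    ext x i
    simp [y, Matrix.mulVec, dotProduct]
  have hH0 : H ≠ 0 := fun h0 => hA₁ (by
    have := hH fun ij => A₁ ij.1 ij.2
    rw [h0, map_zero] at this
    exact this.symm)
  have hlies := liesOnHypersurface_of_generic y hH0 (N := N)
    (fun a ha => (hy a).symm ▸ h _ (hH a ▸ ha)) fun ij => A₀ ij.1 ij.2
  rw [hy] at hlies
  exact hlies

theorem exists_mem_evalSystem_ne_zero [Infinite K] [Finite ι] [Fintype κ] {W : Set (κ → K)}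
    {A₀ : Matrix ι κ K} (hA₀ : vanishingIdeal K (A₀.mulVec '' W) = ⊥)
    {G : MvPolynomial ((ι × κ) ⊕ ι) K} (hG : G ≠ 0) :
    ∃ A : Matrix ι κ K, ∃ x ∈ W, evalSystem A (A.mulVec x) G ≠ 0 := by
  by_contra! h
  obtain ⟨A₁, b, hA₁⟩ := exists_evalSystem_ne_zero hG
  suffices hlies : LiesOnHypersurface G.totalDegree (A₀.mulVec '' W) by
    obtain ⟨P, hP, hP0, -⟩ := hlies
    exact hP0 (hA₀.le hP)
  refine liesOnHypersurface_image_mulVec_of_generic id hA₁ (fun A hA => ?_) A₀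
  refine ⟨evalSystem (A.map C) X G, ?_, fun h0 => hA ?_,
    totalDegree_aeval_le_of_totalDegree_le_one (fun i => ?_) G⟩
  · rintro _ ⟨x, hx, rfl⟩
    exact (eval_evalSystem_map_C A _ G).trans (h A x hx)
  · rw [Matrix.submatrix_id_id, ← eval_evalSystem_map_C, h0, map_zero]
  · cases i <;> simp

theorem exists_evalSystem_encard_eq {n r : ℕ} {W : Set (Fin n → K)} {D : ℕ∞}
    (h : GeneralSectionCount W r D) {c : Fin r → Fin n} (hc : Function.Injective c) :
    ∃ G : MvPolynomial ((Fin r × Fin n) ⊕ Fin r) K, G ≠ 0 ∧ ∀ (A : Matrix (Fin r) (Fin n) K) b,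
      evalSystem A b G ≠ 0 → (W ∩ {x | A.mulVec x = b}).encard = D := by
  obtain ⟨G, hG0, hG⟩ := h
  let Δ : MvPolynomial ((Fin r × Fin n) ⊕ Fin r) K :=
    (Matrix.of fun i j => X (Sum.inl (i, c j))).det
  have hΔ (A : Matrix (Fin r) (Fin n) K) (b) : evalSystem A b Δ = (A.submatrix id c).det := by
    rw [evalSystem, AlgHom.map_det]
    congr 1
    ext i j
    simp
  refine ⟨G * Δ, mul_ne_zero hG0 fun h0 => ?_, fun A b hA => ?_⟩
  · have hdet := hΔ (((1 : Matrix (Fin n) (Fin n) K)).submatrix c id) 0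
    rw [Matrix.submatrix_submatrix, Function.comp_id, Function.id_comp, Matrix.submatrix_one c hc,
      Matrix.det_one, h0, evalSystem, map_zero] at hdet
    exact zero_ne_one hdet
  · rw [evalSystem, map_mul] at hA
    refine hG A b (le_antisymm A.rank_le_height ?_) (left_ne_zero_of_mul hA)
    have hdet : (A.submatrix id c).det ≠ 0 := hΔ A b ▸ right_ne_zero_of_mul hA
    have hrank := Matrix.rank_of_isUnit _ ((Matrix.isUnit_iff_isUnit_det _).mpr hdet.isUnit)
    rw [Fintype.card_fin] at hrank
    exact hrank.ge.trans (A.rank_submatrix_le id c)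

variable {n r : ℕ}

/-- The matrix with rows `Aᵢ₊₁ - vᵢ A₀`, whose forms vanish, together with the first row of `A`,
at the same points as the forms of `A`. -/
def shearMatrix (A : Matrix (Fin (r + 1)) (Fin n) K) (v : Fin r → K) :
    Matrix (Fin r) (Fin n) K :=
  Matrix.of fun i j => A i.succ j - v i * A 0 j

theorem shearMatrix_mulVec (A : Matrix (Fin (r + 1)) (Fin n) K) (v : Fin r → K) (x : Fin n → K)
    (i : Fin r) : (shearMatrix A v).mulVec x i = A.mulVec x i.succ - v i * A.mulVec x 0 := by
  simp [shearMatrix, Matrix.mulVec, dotProduct, sub_mul, Finset.sum_sub_distrib, Finset.mul_sum,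
    mul_assoc]

theorem exists_forall_evalSystem_shearMatrix_ne_zero {A : Matrix (Fin (r + 1)) (Fin n) K}
    {b : Fin r → K} {G : MvPolynomial ((Fin r × Fin n) ⊕ Fin r) K}
    (hA : evalSystem (A.submatrix Fin.succ id) b G ≠ 0) :
    ∃ q : MvPolynomial (Fin r) K, q ≠ 0 ∧ ∀ v, eval v q ≠ 0 →
      evalSystem (shearMatrix A v) b G ≠ 0 := by
  let q : MvPolynomial (Fin r) K := evalSystem
    (Matrix.of fun i j => C (A i.succ j) - X i * C (A 0 j)) (fun i => C (b i)) G
  have hq (v) : eval v q = evalSystem (shearMatrix A v) b G := by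
    rw [eval_evalSystem]
    congr 1
    · ext i j
      simp [shearMatrix]
    · simp
  refine ⟨q, fun h0 => hA ?_, fun v hv => hq v ▸ hv⟩
  have hzero : A.submatrix Fin.succ id = shearMatrix A 0 := by
    ext i j
    simp [shearMatrix]
  rw [hzero, ← hq, h0, map_zero]

theorem polyMap_toMvPolynomial {m : ℕ} (A : Matrix (Fin m) (Fin n) K) :
    polyMap K A.toMvPolynomial = A.mulVec :=
  funext₂ fun x i => A.toMvPolynomial_eval_eq_apply i x

theorem shearEquiv_mem_vanishingIdeal {A : Matrix (Fin (r + 1)) (Fin n) K} {W : Set (Fin n → K)}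
    {P : MvPolynomial (Fin (r + 1)) K} (hP : P ∈ vanishingIdeal K (A.mulVec '' W))
    (v : Fin r → K) :
    shearEquiv v P ∈ vanishingIdeal K
      (polyMap K (Fin.cons (A.toMvPolynomial 0) (shearMatrix A v).toMvPolynomial) '' W) := by
  rintro _ ⟨x, hx, rfl⟩
  have hcons : Fin.cons (A.mulVec x 0)
      (fun i => (shearMatrix A v).mulVec x i + v i * A.mulVec x 0) = A.mulVec x := by
    funext i
    cases i using Fin.cases <;> simp [shearMatrix_mulVec]
  rw [polyMap_cons, polyMap_toMvPolynomial, Matrix.toMvPolynomial_eval_eq_apply, aeval_eq_eval,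
    eval_shearEquiv, hcons]
  exact hP _ ⟨x, hx, rfl⟩

theorem liesOnHypersurface_image_mulVec_of_evalSystem_ne_zero [IsAlgClosed K]
    {W : Set (Fin n → K)} (hW : IsIrreducibleVariety K W)
    (hdep : ∀ z : Fin (r + 1) → MvPolynomial (Fin n) K, vanishingIdeal K (polyMap K z '' W) ≠ ⊥)
    {G : MvPolynomial ((Fin r × Fin n) ⊕ Fin r) K} {δ : ℕ} (hδ : δ ≠ 0)
    (hG : ∀ (A : Matrix (Fin r) (Fin n) K) b, evalSystem A b G ≠ 0 →
      (W ∩ {x | A.mulVec x = b}).encard = δ)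
    {A : Matrix (Fin (r + 1)) (Fin n) K} {b : Fin r → K}
    (hA : evalSystem (A.submatrix Fin.succ id) b G ≠ 0) :
    LiesOnHypersurface δ (A.mulVec '' W) := by
  have : Infinite K := IsAlgClosed.instInfinite
  have hprime : (vanishingIdeal K (A.mulVec '' W)).IsPrime := by
    have := hW.isPrime
    rw [← polyMap_toMvPolynomial, vanishingIdeal_image_polyMap]
    exact Ideal.IsPrime.comap _
  obtain ⟨P, hPW, hP⟩ :=
    hprime.exists_mem_prime_of_ne_bot (polyMap_toMvPolynomial A ▸ hdep A.toMvPolynomial)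
  refine ⟨P, hPW, hP.ne_zero, ?_⟩
  obtain ⟨q₁, hq₁, hsys⟩ := exists_forall_evalSystem_shearMatrix_ne_zero hA
  obtain ⟨q₂, hq₂, hdeg⟩ := exists_forall_natDegree_shearEquiv hP.ne_zero
  obtain ⟨q₃, hq₃, hder⟩ :=
    exists_forall_derivative_shearEquiv_ne_zero (exists_pderiv_ne_zero hP.irreducible)
  obtain ⟨v, hv⟩ := exists_eval_ne_zero (mul_ne_zero (mul_ne_zero hq₁ hq₂) hq₃)
  simp only [map_mul, mul_ne_zero_iff] at hv
  obtain ⟨⟨hv₁, hv₂⟩, hv₃⟩ := hv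
  rw [← hdeg v hv₂]
  refine natDegree_le_of_forall_encard_eq hW.1 (G := evalSystem ((shearMatrix A v).map C) X G)
    (f := A.toMvPolynomial 0) (g := (shearMatrix A v).toMvPolynomial) (fun h0 => hsys v hv₁ ?_) hδ
    (fun b hb => ?_) (fun j => hdep _)
    ((MulEquiv.irreducible_iff (shearEquiv v)).mpr hP.irreducible)
    (shearEquiv_mem_vanishingIdeal hPW v) (hder v hv₃)
  · rw [← eval_evalSystem_map_C, h0, map_zero]
  · rw [polyMap_toMvPolynomial]
    exact hG _ b (eval_evalSystem_map_C _ b G ▸ hb)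

end LinearSections

section Degree

variable {K : Type*} [Field K] {n r k d : ℕ} {V W : Set (Fin n → K)}

theorem exists_generalSectionCount_of_irreducibleDegree_ne_top (h : irreducibleDegree W ≠ ⊤) :
    ∃ r δ : ℕ, affineDim K W = r ∧ GeneralSectionCount W r δ ∧ irreducibleDegree W = δ := by
  have hne : {D : ℕ∞ | ∃ r : ℕ, affineDim K W = r ∧ GeneralSectionCount W r D}.Nonempty := by
    by_contra hempty
    rw [Set.not_nonempty_iff_eq_empty] at hempty
    rw [irreducibleDegree, hempty, sInf_empty] at h
    exact h rfl
  obtain ⟨r, hr, hcount⟩ := csInf_mem hne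
  obtain ⟨δ, hδ⟩ := ENat.ne_top_iff_exists.mp h
  exact ⟨r, δ, hr, hδ ▸ hcount, hδ.symm⟩

theorem one_submatrix_mulVec {R ι κ : Type*} [NonAssocSemiring R] [Fintype κ] [DecidableEq κ]
    (c : ι → κ) (x : κ → R) : ((1 : Matrix κ κ R).submatrix c id).mulVec x = x ∘ c :=
  congrArg (· ∘ c) (Matrix.one_mulVec x)

section Irreducible

variable [IsAlgClosed K]

theorem trdeg_coordinateRing (hW : IsIrreducibleVariety K W) (hr : affineDim K W = r) :
    Algebra.trdeg K (CoordinateRing K W) = r := by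
  have := hW.isPrime
  rw [affineDim_eq_ringKrullDim hW.1] at hr
  exact trdeg_eq_of_ringKrullDim_eq hr

theorem vanishingIdeal_image_polyMap_ne_bot (hW : IsIrreducibleVariety K W)
    (hr : affineDim K W = r) (z : Fin (r + 1) → MvPolynomial (Fin n) K) :
    vanishingIdeal K (polyMap K z '' W) ≠ ⊥ := by
  have := hW.isPrime
  intro hbot
  have hcard := (algebraicIndependent_mk_iff.mpr hbot).lift_cardinalMk_le_trdeg
  rw [trdeg_coordinateRing hW hr, Cardinal.mk_fin, Cardinal.lift_natCast,
    Cardinal.lift_natCast] at hcard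
  exact absurd (Nat.cast_le.mp hcard) (Nat.lt_irrefl r)

theorem exists_independent_coordinates (hW : IsIrreducibleVariety K W)
    (hr : affineDim K W = r) :
    ∃ c : Fin r → Fin n, Function.Injective c ∧ vanishingIdeal K ((· ∘ c) '' W) = ⊥ := by
  have := hW.isPrime
  let y (j : Fin n) : CoordinateRing K W := Ideal.Quotient.mk (vanishingIdeal K W) (X j)
  have : Algebra.IsAlgebraic (Algebra.adjoin K (Set.range y)) (CoordinateRing K W) :=
    ⟨fun x => isAlgebraic_algebraMap (⟨x, adjoin_range_mk_X K _ ▸ Algebra.mem_top⟩ :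
      Algebra.adjoin K (Set.range y))⟩
  obtain ⟨t, ht, hbasis⟩ := exists_isTranscendenceBasis_subset (R := K) (Set.range y)
  have : Finite t := (Set.finite_range y).subset ht
  have hcard : Nat.card t = r := by
    rw [Nat.card, hbasis.cardinalMk_eq_trdeg, trdeg_coordinateRing hW hr, Cardinal.toNat_natCast]
  let e : Fin r ≃ t := (Finite.equivFinOfCardEq hcard).symm
  choose c hc using fun i => ht (e i).2
  have hcoord : polyMap K (fun i => (X (c i) : MvPolynomial (Fin n) K)) = (· ∘ c) :=
    funext₂ fun x i => aeval_X x (c i)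
  refine ⟨c, fun i j hij => e.injective (Subtype.ext ?_), ?_⟩
  · rw [← hc, ← hc, hij]
  · rw [← hcoord, ← algebraicIndependent_mk_iff]
    convert hbasis.1.comp e e.injective using 1
    exact funext hc

theorem liesOnHypersurface_image_mulVec (hW : IsIrreducibleVariety K W)
    (hr : affineDim K W = r) {δ : ℕ} (hδ : GeneralSectionCount W r δ)
    (A : Matrix (Fin (r + 1)) (Fin n) K) : LiesOnHypersurface δ (A.mulVec '' W) := by
  have : Infinite K := IsAlgClosed.instInfinite
  obtain ⟨c, hc, hind⟩ := exists_independent_coordinates hW hr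
  obtain ⟨G, hG0, hG⟩ := exists_evalSystem_encard_eq hδ hc
  have hδ0 : δ ≠ 0 := by
    simp only [← one_submatrix_mulVec] at hind
    obtain ⟨A₁, x, hx, hA₁⟩ := exists_mem_evalSystem_ne_zero hind hG0
    rintro rfl
    have hempty := Set.encard_eq_zero.mp (hG _ _ hA₁)
    exact Set.notMem_empty x (hempty ▸ ⟨hx, rfl⟩)
  obtain ⟨A₁, b, hA₁⟩ := exists_evalSystem_ne_zero hG0
  exact liesOnHypersurface_image_mulVec_of_generic Fin.succ (A₁ := Fin.cons 0 A₁) hA₁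
    (fun _ => liesOnHypersurface_image_mulVec_of_evalSystem_ne_zero hW
      (vanishingIdeal_image_polyMap_ne_bot hW hr) hδ0 hG) A

theorem exists_liesOnHypersurface_image_comp_of_irreducible (hW : IsIrreducibleVariety K W)
    (hdim : affineDim K W ≤ k) (hdeg : irreducibleDegree W ≠ ⊤) (e : Fin (k + 1) → Fin n) :
    ∃ δ : ℕ, irreducibleDegree W = δ ∧ LiesOnHypersurface δ ((· ∘ e) '' W) := by
  obtain ⟨r, δ, hr, hcount, hδ⟩ := exists_generalSectionCount_of_irreducibleDegree_ne_top hdeg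
  have hrk : r ≤ k := by exact_mod_cast hr ▸ hdim
  have hlies := liesOnHypersurface_image_mulVec hW hr hcount
    ((1 : Matrix (Fin n) (Fin n) K).submatrix (e ∘ Fin.castLE (Nat.succ_le_succ hrk)) id)
  refine ⟨δ, hδ, .of_image_comp (Fin.castLE_injective (Nat.succ_le_succ hrk)) ?_⟩
  rw [Set.image_image]
  simpa only [one_submatrix_mulVec, ← Function.comp_assoc] using hlies

theorem isIrreducibleComponent_of_mem_minimalPrimes (hV : IsAffineVariety K V)
    {P : Ideal (MvPolynomial (Fin n) K)} (hP : P ∈ (vanishingIdeal K V).minimalPrimes) :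
    IsIrreducibleComponent K V (zeroLocus K P) := by
  have : P.IsPrime := hP.1.1
  refine ⟨⟨isIrreducibleVariety_zeroLocus P, ?_⟩, fun W hW hPW => ?_⟩
  · conv_rhs => rw [← isAffineVariety_iff.mp hV]
    exact zeroLocus_anti_mono hP.1.2
  · have hle : vanishingIdeal K W ≤ P := by
      conv_rhs => rw [← IsPrime.vanishingIdeal_zeroLocus (K := K) P]
      exact vanishingIdeal_anti_mono hPW
    conv_lhs => rw [← isAffineVariety_iff.mp hW.1.1]
    exact zeroLocus_anti_mono (hP.2 ⟨hW.1.isPrime, vanishingIdeal_anti_mono hW.2⟩ hle)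

theorem exists_finset_isIrreducibleComponent (hV : IsAffineVariety K V) :
    ∃ s : Finset {W : Set (Fin n → K) // IsIrreducibleComponent K V W}, V ⊆ ⋃ W ∈ s, W.1 := by
  classical
  have hfin := Ideal.finite_minimalPrimes_of_isNoetherianRing _ (vanishingIdeal K V)
  refine ⟨hfin.toFinset.attach.image fun P => ⟨zeroLocus K P.1,
    isIrreducibleComponent_of_mem_minimalPrimes hV (hfin.mem_toFinset.mp P.2)⟩, fun x hx => ?_⟩
  have hle : vanishingIdeal K V ≤ vanishingIdeal K {x} :=
    vanishingIdeal_anti_mono (Set.singleton_subset_iff.mpr hx)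
  obtain ⟨P, hP, hPx⟩ := Ideal.exists_minimalPrimes_le hle
  exact Set.mem_biUnion (Finset.mem_image_of_mem _
    (Finset.mem_attach _ ⟨P, hfin.mem_toFinset.mpr hP⟩)) fun p hp => hPx hp x rfl

end Irreducible

theorem liesOnHypersurface_image_comp {F : Type*} [Field F] [Algebra F K] [IsAlgClosed K]
    [Algebra.IsAlgebraic F K] (hV : IsAffineVariety F V) (hdim : affineDim F V ≤ k)
    (hdeg : affineDegree V ≤ d) (e : Fin (k + 1) → Fin n) :
    LiesOnHypersurface d ((· ∘ e) '' V) := by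
  obtain ⟨s, hs⟩ := exists_finset_isIrreducibleComponent hV.baseChange
  have hsum : ∑ W ∈ s, irreducibleDegree W.1 ≤ d :=
    (le_iSup (fun s : Finset {W : Set (Fin n → K) // IsIrreducibleComponent K V W} =>
      ∑ W ∈ s, irreducibleDegree W.1) s).trans hdeg
  have hcomp : ∀ W ∈ s, ∃ δ : ℕ, irreducibleDegree W.1 = δ ∧
      LiesOnHypersurface δ ((· ∘ e) '' W.1) := fun W hW =>
    exists_liesOnHypersurface_image_comp_of_irreducible W.2.1.1
      ((affineDim_le_affineDim_of_subset F hV W.2.1.1.1 W.2.1.2).trans hdim)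
      (ne_top_of_le_ne_top (ENat.natCast_ne_top d)
        ((Finset.single_le_sum (fun _ _ => zero_le) hW).trans hsum)) e
  choose! δ hδ hlies using hcomp
  refine (LiesOnHypersurface.biUnion hlies).mono ?_ ?_
  · rw [Finset.sum_congr rfl hδ] at hsum
    exact_mod_cast hsum
  · rw [← Set.image_iUnion₂]
    exact Set.image_mono hs

end Degree

section Integrality

universe u

theorem isIntegralElem_of_forall_valuationSubring {R L : Type*} [CommRing R] [Field L]
    {τ : R →+* L} {y : L} (h : ∀ O : ValuationSubring L, (∀ r, τ r ∈ O) → y ∈ O) :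
    τ.IsIntegralElem y := by
  have hy : y ∈ (integralClosure (Subring.closure (Set.range τ)) L).toSubring := by
    rw [← iInf_valuationSubring_superset, Subring.mem_iInf]
    exact fun O => h O.1 fun r => O.2 ⟨r, rfl⟩
  rw [← RingHom.coe_range, Subring.closure_eq] at hy
  obtain ⟨p, hp, hpy⟩ := hy
  obtain ⟨q, rfl, -, hq⟩ := Polynomial.lifts_and_natDegree_eq_and_monic
    ((Polynomial.mem_lifts _).mpr
      (Polynomial.map_surjective τ.rangeRestrict τ.rangeRestrict_surjective p)) hp
  exact ⟨q, hq, by rwa [Polynomial.eval₂_map] at hpy⟩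

theorem isIntegralElem_of_forall_isPrime {R A : Type*} [CommRing R] [CommRing A] {φ : R →+* A}
    {x : A} (h : ∀ Q : Ideal A, Q.IsPrime →
      ((Ideal.Quotient.mk Q).comp φ).IsIntegralElem (Ideal.Quotient.mk Q x)) :
    φ.IsIntegralElem x := by
  let M : Submonoid A :=
    { carrier := {t | ∃ p : Polynomial R, p.Monic ∧ p.eval₂ φ x = t}
      one_mem' := ⟨1, Polynomial.monic_one, Polynomial.eval₂_one φ x⟩
      mul_mem' := by
        rintro _ _ ⟨p, hp, rfl⟩ ⟨q, hq, rfl⟩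
        exact ⟨p * q, hp.mul hq, Polynomial.eval₂_mul φ x⟩ }
  by_contra hx
  have hdisj : Disjoint ((⊥ : Ideal A) : Set A) M := by
    rw [Set.disjoint_left]
    rintro t ht ⟨p, hp, hpt⟩
    exact hx ⟨p, hp, hpt.trans ht⟩
  obtain ⟨Q, hQ, -, hQM⟩ := Ideal.exists_le_prime_disjoint _ M hdisj
  obtain ⟨p, hp, hpx⟩ := h Q hQ
  rw [← Polynomial.hom_eval₂, Ideal.Quotient.eq_zero_iff_mem] at hpx
  exact Set.disjoint_left.mp hQM hpx ⟨p, hp, rfl⟩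

theorem isIntegralElem_of_forall_field_valuationSubring {R : Type*} {A : Type u} [CommRing R]
    [CommRing A] {φ : R →+* A} {x : A}
    (h : ∀ (L : Type u) [Field L] (f : A →+* L) (O : ValuationSubring L),
      (∀ r, f (φ r) ∈ O) → f x ∈ O) : φ.IsIntegralElem x :=
  isIntegralElem_of_forall_isPrime fun Q _ =>
    let j := algebraMap (A ⧸ Q) (FractionRing (A ⧸ Q))
    RingHom.IsIntegralElem.of_map (g := j) (IsFractionRing.injective _ _)
      (isIntegralElem_of_forall_valuationSubring (τ := j.comp ((Ideal.Quotient.mk Q).comp φ))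
        (h _ (j.comp (Ideal.Quotient.mk Q))))

end Integrality

section Valuations

variable {F K L Γ₀ : Type*} [Field F] [Field K] [Field L] [Algebra F L] [Algebra K L]
  [LinearOrderedCommGroupWithZero Γ₀]

theorem isTrivialOn_of_isAlgebraic (F : Type*) [Field F] [Algebra F K] [Algebra F L]
    [IsScalarTower F K L] [Algebra.IsAlgebraic F K] (v : Valuation L Γ₀) [v.IsTrivialOn F] :
    v.IsTrivialOn K where
  eq_one c hc := by
    by_contra hv
    exact Valuation.transcendental_of_ne_one F _ ((map_ne_zero _).mpr hc) hv
      ((Algebra.IsAlgebraic.isAlgebraic c).algebraMap)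

theorem eq_of_sum_mul_prod_erase_eq {ι : Type*} [Fintype ι] [DecidableEq ι] {e : ι → ℕ}
    (hcop : Pairwise fun i j => Nat.Coprime (e i) (e j)) {a b : ι → ℕ}
    (ha : ∀ j, a j < e j) (hb : ∀ j, b j < e j)
    (h : ∑ j, a j * ∏ i ∈ Finset.univ.erase j, e i = ∑ j, b j * ∏ i ∈ Finset.univ.erase j, e i) :
    a = b := by
  funext j
  have hmod : ∀ a : ι → ℕ, ∑ l, a l * ∏ i ∈ Finset.univ.erase l, e i ≡
      a j * ∏ i ∈ Finset.univ.erase j, e i [MOD e j] := fun a => by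
    rw [← Finset.add_sum_erase _ _ (Finset.mem_univ j)]
    refine Nat.ModEq.add_left _ (Nat.modEq_zero_iff_dvd.mpr (Finset.dvd_sum fun l hl => ?_))
    exact (Finset.dvd_prod_of_mem e (Finset.mem_erase.mpr
      ⟨(Finset.ne_of_mem_erase hl).symm, Finset.mem_univ _⟩)).mul_left _
  have hgcd : Nat.gcd (e j) (∏ i ∈ Finset.univ.erase j, e i) = 1 :=
    Nat.Coprime.prod_right fun i hi => hcop (Finset.ne_of_mem_erase hi).symm
  have hj : a j * ∏ i ∈ Finset.univ.erase j, e i ≡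
      b j * ∏ i ∈ Finset.univ.erase j, e i [MOD e j] :=
    (hmod a).symm.trans (h ▸ hmod b)
  exact (Nat.ModEq.cancel_right_of_coprime hgcd hj).eq_of_lt_of_lt (ha j) (hb j)

theorem aeval_ne_zero_of_valuation_pow_eq {σ : Type*} [Finite σ] (v : Valuation L Γ₀)
    [v.IsTrivialOn K] {e : σ → ℕ} (hcop : Pairwise fun i j => Nat.Coprime (e i) (e j)) {γ : Γ₀}
    (hγ : 1 < γ) {y : σ → L} (hy : ∀ i, v (y i) ^ e i = γ) {P : MvPolynomial σ K} (hP : P ≠ 0)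
    (hPe : ∀ α ∈ P.support, ∀ i, α i < e i) : aeval y P ≠ 0 := by
  classical
  cases nonempty_fintype σ
  let weight : (σ →₀ ℕ) → ℕ := fun α => ∑ j, α j * ∏ i ∈ Finset.univ.erase j, e i
  let term : (σ →₀ ℕ) → L := fun α => algebraMap K L (coeff α P) * ∏ i, y i ^ α i
  have hterm : ∀ α ∈ P.support, v (term α) ^ ∏ i, e i = γ ^ weight α := fun α hα => by
    simp only [term, map_mul, map_prod, map_pow, one_mul,
      Valuation.IsTrivialOn.eq_one (v := v) _ (mem_support_iff.mp hα)]
    rw [← Finset.prod_pow, ← Finset.prod_pow_eq_pow_sum]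
    refine Finset.prod_congr rfl fun j _ => ?_
    rw [← hy j, ← pow_mul, ← pow_mul, ← Finset.mul_prod_erase _ e (Finset.mem_univ j),
      mul_left_comm]
  obtain ⟨α, hα, hmax⟩ := P.support.exists_max_image weight (support_nonempty.mpr hP)
  have hlt : ∀ β ∈ P.support \ {α}, v (term β) < v (term α) := fun β hβ => by
    obtain ⟨hβ, hne⟩ := Finset.mem_sdiff.mp hβ
    refine lt_of_pow_lt_pow_left₀ (∏ i, e i) zero_le ?_
    rw [hterm β hβ, hterm α hα]
    refine pow_lt_pow_right₀ hγ ((hmax β hβ).lt_of_ne fun h => hne ?_)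
    exact Finset.mem_singleton.mpr (DFunLike.coe_injective
      (eq_of_sum_mul_prod_erase_eq hcop (hPe β hβ) (hPe α hα) h))
  rw [aeval_def, eval₂_eq', ← v.ne_zero_iff, v.map_sum_eq_of_lt hα hlt]
  intro h
  have hzero := hterm α hα
  rw [h, zero_pow (Finset.prod_ne_zero_iff.mpr fun i _ => (hPe α hα i).ne_bot)] at hzero
  exact (pow_pos (zero_lt_one.trans hγ) _).ne hzero

theorem IsRegularMatrix.exists_combination {m n k : ℕ} {M : Matrix (Fin m) (Fin n) F}
    (hM : IsRegularMatrix k M) {S : Finset (Fin n)} (hS : S.card = k) {t : Fin n} (ht : t ∈ S) :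
    ∃ l : Fin m → F, ∑ i, l i * M i t = 1 ∧ ∀ j ∈ S, j ≠ t → ∑ i, l i * M i j = 0 := by
  obtain ⟨g, hg⟩ := LinearMap.exists_leftInverse_of_injective _
    (LinearMap.ker_eq_bot.mpr (hM S hS))
  obtain ⟨l, hl⟩ := (dotProductEquiv F (Fin m)).surjective (Finsupp.lapply ⟨t, ht⟩ ∘ₗ g)
  have hdual : ∀ j : S, ∑ i, l i * M i j = Finsupp.single j 1 ⟨t, ht⟩ := fun j => by
    have hgj := LinearMap.congr_fun hg (Finsupp.single j 1)
    rw [LinearMap.comp_apply, Finsupp.linearCombination_single, one_smul] at hgj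
    exact (LinearMap.congr_fun hl fun i => M i j).trans (congrArg (· ⟨t, ht⟩) hgj)
  refine ⟨l, (hdual ⟨t, ht⟩).trans Finsupp.single_eq_same, fun j hj hjt => ?_⟩
  exact (hdual ⟨j, hj⟩).trans
    (Finsupp.single_eq_of_ne fun h => hjt (congrArg Subtype.val h).symm)

theorem IsRegularMatrix.lt_card_of_valuation_sum_le_one {m n k : ℕ}
    {M : Matrix (Fin m) (Fin n) F} (hM : IsRegularMatrix k M) (hk : k ≤ n)
    (v : Valuation L Γ₀) [v.IsTrivialOn F] {z : Fin n → L} {γ : Γ₀} (hγ : 1 < γ)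
    (hz : ∀ j, v (z j) ≤ γ) (hforms : ∀ i, v (∑ j, M i j • z j) ≤ 1) {S : Finset (Fin n)}
    (hS : ∀ j, v (z j) = γ → j ∈ S) {t : Fin n} (ht : v (z t) = γ) : k < S.card := by
  by_contra! hcard
  obtain ⟨T, hST, -, hT⟩ := Finset.exists_subsuperset_card_eq (Finset.subset_univ S) hcard
    (by rwa [Finset.card_fin])
  obtain ⟨l, hlt, hl⟩ := hM.exists_combination hT (hST (hS t ht))
  have hswap : ∑ i, l i • ∑ j, M i j • z j = ∑ j, (∑ i, l i * M i j) • z j := by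
    simp only [Finset.smul_sum, smul_smul, Finset.sum_smul]
    exact Finset.sum_comm
  have hsmul : ∀ (c : F) (x : L), v (c • x) ≤ v x := fun c x => by
    rw [Algebra.smul_def, map_mul]
    exact mul_le_of_le_one_left' (Valuation.IsTrivialOn.valuation_algebraMap_le_one v c)
  have hle : v (∑ j, (∑ i, l i * M i j) • z j) ≤ 1 := by
    rw [← hswap]
    exact v.map_sum_le fun i _ => (hsmul _ _).trans (hforms i)
  have heq : v (∑ j, (∑ i, l i * M i j) • z j) = γ := by
    rw [v.map_sum_eq_of_lt (Finset.mem_univ t), hlt, one_smul, ht]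
    intro j hj
    rw [hlt, one_smul, ht]
    by_cases hjT : j ∈ T
    · rw [hl j hjT (by simpa using hj), zero_smul, map_zero]
      exact zero_lt_one.trans hγ
    · exact (hsmul _ _).trans_lt ((hz j).lt_of_ne fun h => hjT (hST (hS j h)))
  exact (heq ▸ hle).not_gt hγ

theorem valuation_le_one_of_relations {m n k d : ℕ} [Algebra F K] [IsScalarTower F K L]
    [Algebra.IsAlgebraic F K] (v : Valuation L Γ₀) [v.IsTrivialOn F] (hk : k ≤ n) {e : Fin n → ℕ}
    (he : ∀ j, d < e j) (hcop : Pairwise fun i j => Nat.Coprime (e i) (e j))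
    {M : Matrix (Fin m) (Fin n) F} (hM : IsRegularMatrix k M) {x : Fin n → L}
    (hforms : ∀ i, v (∑ j, M i j • x j ^ e j) ≤ 1)
    (hrel : ∀ c : Fin (k + 1) → Fin n, ∃ P : MvPolynomial (Fin (k + 1)) K,
      P ≠ 0 ∧ P.totalDegree ≤ d ∧ aeval (x ∘ c) P = 0) (j : Fin n) : v (x j) ≤ 1 := by
  by_contra! hj
  have := isTrivialOn_of_isAlgebraic (K := K) F v
  obtain ⟨t, -, ht⟩ := Finset.univ.exists_max_image (fun j => v (x j ^ e j)) ⟨j, Finset.mem_univ j⟩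
  have hγ : 1 < v (x t ^ e t) := by
    refine lt_of_lt_of_le ?_ (ht j (Finset.mem_univ j))
    rw [map_pow]
    exact one_lt_pow₀ hj (he j).ne_bot
  let S := Finset.univ.filter fun j => v (x j ^ e j) = v (x t ^ e t)
  have hS : ∀ j, j ∈ S ↔ v (x j ^ e j) = v (x t ^ e t) :=
    fun _ => Finset.mem_filter_univ _
  have hcard : k < S.card := hM.lt_card_of_valuation_sum_le_one hk v hγ
    (fun j => ht j (Finset.mem_univ j)) hforms (fun j => (hS j).mpr) rfl
  obtain ⟨T, hTS, hT⟩ := Finset.exists_subset_card_eq hcard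
  obtain ⟨P, hP, hPd, hPx⟩ := hrel (T.orderEmbOfFin hT)
  refine aeval_ne_zero_of_valuation_pow_eq v (e := e ∘ T.orderEmbOfFin hT)
    (fun i j hij => hcop ((T.orderEmbOfFin hT).injective.ne hij)) hγ (fun i => ?_) hP
    (fun α hα i => ?_) hPx
  · simpa using (hS _).mp (hTS (T.orderEmbOfFin_mem hT i))
  · exact ((Finsupp.le_degree i α).trans ((le_totalDegree hα).trans hPd)).trans_lt (he _)

end Valuations

section Finiteness

universe u

theorem aeval_mk_X {R σ : Type*} [CommRing R] (I : Ideal (MvPolynomial σ R))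
    (p : MvPolynomial σ R) :
    aeval (fun i => Ideal.Quotient.mk I (X i)) p = Ideal.Quotient.mk I p :=
  (DFunLike.congr_fun (aeval_unique (Ideal.Quotient.mkₐ R I)) p).symm

variable {F K : Type*} [Field F] [Field K] [Algebra F K] [Algebra.IsAlgebraic F K] {n m k d : ℕ}
  {e : Fin n → ℕ} {M : Matrix (Fin m) (Fin n) F}

theorem isIntegralElem_of_relations {R : Type*} {A : Type u} [CommRing R] [CommRing A] [Algebra F A]
    [Algebra K A] [IsScalarTower F K A] (hk : k ≤ n) (he : ∀ j, d < e j)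
    (hcop : Pairwise fun i j => Nat.Coprime (e i) (e j)) (hM : IsRegularMatrix k M) {φ : R →+* A}
    {x : Fin n → A} (hF : ∀ c : F, algebraMap F A c ∈ φ.range)
    (hforms : ∀ i, ∑ j, M i j • x j ^ e j ∈ φ.range)
    (hrel : ∀ c : Fin (k + 1) → Fin n, ∃ P : MvPolynomial (Fin (k + 1)) K,
      P ≠ 0 ∧ P.totalDegree ≤ d ∧ aeval (x ∘ c) P = 0) (j : Fin n) : φ.IsIntegralElem (x j) := by
  refine isIntegralElem_of_forall_field_valuationSubring fun L _ f O hO => ?_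
  have hfO : ∀ a ∈ φ.range, O.valuation (f a) ≤ 1 := by
    rintro _ ⟨r, rfl⟩
    exact (O.valuation_le_one_iff _).mpr (hO r)
  let : Algebra K L := (f.comp (algebraMap K A)).toAlgebra
  let : Algebra F L := (f.comp (algebraMap F A)).toAlgebra
  have : IsScalarTower F K L := .of_algebraMap_eq fun c =>
    congrArg f (IsScalarTower.algebraMap_apply F K A c)
  have : O.valuation.IsTrivialOn F := .of_le_one _ fun c => hfO _ (hF c)
  let fF : A →ₐ[F] L := { f with commutes' := fun _ => rfl }
  let fK : A →ₐ[K] L := { f with commutes' := fun _ => rfl }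
  refine (O.valuation_le_one_iff _).mp
    (valuation_le_one_of_relations (K := K) O.valuation (x := f ∘ x) hk he hcop hM (fun i => ?_)
      (fun c => ?_) j)
  · have h : fF (∑ j, M i j • x j ^ e j) = ∑ j, M i j • (f ∘ x) j ^ e j := by
      simp only [map_sum, map_smul, map_pow]
      rfl
    exact h ▸ hfO _ (hforms i)
  · obtain ⟨P, hP, hPd, hPx⟩ := hrel c
    refine ⟨P, hP, hPd, ?_⟩
    exact (comp_aeval_apply (x ∘ c) fK P).symm.trans ((congrArg f hPx).trans (map_zero f))

variable [IsAlgClosed K] {V : Set (Fin n → K)}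

theorem exists_aeval_mk_X_comp_eq_zero (hV : IsAffineVariety F V) (hdim : affineDim F V ≤ k)
    (hdeg : affineDegree V ≤ d) (c : Fin (k + 1) → Fin n) :
    ∃ P : MvPolynomial (Fin (k + 1)) K, P ≠ 0 ∧ P.totalDegree ≤ d ∧
      aeval ((fun j => Ideal.Quotient.mk (vanishingIdeal K V) (X j)) ∘ c) P = 0 := by
  obtain ⟨P, hPV, hP, hPd⟩ := liesOnHypersurface_image_comp hV hdim hdeg c
  have hPc : rename c P ∈ vanishingIdeal K V := fun a ha => by
    rw [aeval_rename]
    exact hPV _ ⟨a, ha, rfl⟩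
  refine ⟨P, hP, hPd, ?_⟩
  rw [← aeval_rename, aeval_mk_X, Ideal.Quotient.eq_zero_iff_mem.mpr hPc]

theorem isIntegral_mk_X (hk : k ≤ n) (he : ∀ j, d < e j)
    (hcop : Pairwise fun i j => Nat.Coprime (e i) (e j)) (hM : IsRegularMatrix k M)
    (hV : IsAffineVariety F V) (hdim : affineDim F V ≤ k) (hdeg : affineDegree V ≤ d)
    {B : Subalgebra F (CoordinateRing F V)} (hB : ∀ i, Ideal.Quotient.mk _ (dklPoly M e i) ∈ B)
    (j : Fin n) : IsIntegral B (Ideal.Quotient.mk (vanishingIdeal F V) (X j)) := by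
  let φ := (coordinateRingMap F (subset_refl V)).comp (algebraMap B (CoordinateRing F V))
  let x : Fin n → CoordinateRing K V := fun j => Ideal.Quotient.mk _ (X j)
  have hφ : ∀ p : MvPolynomial (Fin n) F, Ideal.Quotient.mk _ p ∈ B → aeval x p ∈ φ.range :=
    fun p hp => ⟨⟨_, hp⟩, by
      rw [← aeval_map_algebraMap K, aeval_mk_X]
      exact coordinateRingMap_mk F (subset_refl V) p⟩
  refine RingHom.IsIntegralElem.of_map (coordinateRingMap_injective F) ?_
  rw [coordinateRingMap_mk, map_X]
  refine isIntegralElem_of_relations (K := K) (φ := φ) (x := x) hk he hcop hM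
    (fun c => ?_) (fun i => ?_) (exists_aeval_mk_X_comp_eq_zero hV hdim hdeg) j
  · exact aeval_C x c ▸ hφ (C c) (B.algebraMap_mem c)
  · simpa only [dklPoly, map_sum, map_mul, map_pow, aeval_C, aeval_X, Algebra.smul_def]
      using hφ _ (hB i)

theorem restrictsToFinite_dklPoly (hk : k ≤ n) (he : ∀ j, d < e j)
    (hcop : Pairwise fun i j => Nat.Coprime (e i) (e j)) (hM : IsRegularMatrix k M)
    (hV : IsAffineVariety F V) (hdim : affineDim F V ≤ k) (hdeg : affineDegree V ≤ d) :
    RestrictsToFinite (dklPoly M e) V := by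
  let B := (comorphism (dklPoly M e) (Set.mapsTo_univ (polyMap K (dklPoly M e)) V)).range
  have hB : ∀ i, Ideal.Quotient.mk _ (dklPoly M e i) ∈ B := fun i =>
    ⟨Ideal.Quotient.mk _ (X i), congrArg (Ideal.Quotient.mk _) (aeval_X _ i)⟩
  have hfg := fg_adjoin_of_finite
    (Set.finite_range fun j => Ideal.Quotient.mk (vanishingIdeal F V) (X j))
    (Set.forall_mem_range.mpr (isIntegral_mk_X hk he hcop hM hV hdim hdeg hB))
  rw [adjoin_eq_top_of_isScalarTower F (adjoin_range_mk_X F (vanishingIdeal F V)),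
    Algebra.top_toSubmodule] at hfg
  exact ⟨hfg⟩

end Finiteness

section Universal

theorem isRegularMatrix_vandermondeMatrix {F : Type*} [Field F] {n : ℕ} (k : ℕ) {ω : Fin n → F}
    (hω : Function.Injective ω) : IsRegularMatrix k (vandermondeMatrix k ω) := fun J hJ => by
  let e : Fin k ≃ J := (J.equivFinOfCardEq hJ).symm
  have hdet : (Matrix.vandermonde fun i => ω (e i)).det ≠ 0 :=
    Matrix.det_vandermonde_ne_zero_iff.mpr fun i j h => e.injective (Subtype.ext (hω h))
  rw [← linearIndependent_equiv e]
  exact Matrix.linearIndependent_rows_of_det_ne_zero hdet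

theorem totalDegree_dklPoly_le {F : Type*} [Field F] {n m : ℕ} (M : Matrix (Fin m) (Fin n) F)
    {e : Fin n → ℕ} {N : ℕ} (he : ∀ j, e j ≤ N) (i : Fin m) : (dklPoly M e i).totalDegree ≤ N := by
  refine totalDegree_finsetSum_le fun j _ => (totalDegree_mul _ _).trans ?_
  rw [totalDegree_C, zero_add, totalDegree_X_pow]
  exact he j

theorem le_mul_log_of_le_mul_log {s q : ℝ} (hs : 2 ≤ s) (hq : 0 < q)
    (h : q ≤ 6 * s * Real.log q) : q ≤ 60 * (s * Real.log s) := by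
  have hsq : √q ^ 2 = q := Real.sq_sqrt hq.le
  have hsqrt : 0 < √q := Real.sqrt_pos.mpr hq
  have hlog : Real.log q ≤ 2 * √q := by
    rw [← hsq, Real.log_pow, hsq]
    exact mul_le_mul_of_nonneg_left (Real.log_le_self hsqrt.le) zero_le_two
  have hroot : √q ≤ 12 * s := by nlinarith
  have hpow : q ≤ s ^ 10 := by
    calc q = √q ^ 2 := hsq.symm
      _ ≤ (12 * s) ^ 2 := by gcongr
      _ ≤ 2 ^ 8 * s ^ 2 := by rw [mul_pow]; gcongr; norm_num
      _ ≤ s ^ 8 * s ^ 2 := by gcongr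
      _ = s ^ 10 := by ring
  have hlog_le : Real.log q ≤ 10 * Real.log s := by
    simpa only [Real.log_pow, Nat.cast_ofNat] using Real.log_le_log hq hpow
  nlinarith

theorem le_six_mul_primeCounting_mul_log {q : ℕ} (hq : 2 ≤ q) :
    (q : ℝ) ≤ 6 * Nat.primeCounting q * Real.log q := by
  have hqR : (2 : ℝ) ≤ q := by exact_mod_cast hq
  have hlog : 0 < Real.log q := Real.log_pos (by linarith)
  have hpi : (1 : ℝ) ≤ Nat.primeCounting q := by
    exact_mod_cast Nat.monotone_primeCounting hq
  have hchebyshev : q * Real.log 2 - Real.log (q + 1) ≤ Nat.primeCounting q * Real.log q :=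
    (div_le_iff₀ hlog).mp (Chebyshev.pi_ge q)
  have hsucc : Real.log (q + 1) ≤ 2 * Real.log q := by
    rw [← Nat.cast_two, ← Real.log_pow]
    exact Real.log_le_log (by positivity) (by nlinarith)
  nlinarith [Real.log_two_gt_d9]

theorem nth_prime_le_mul_log {s : ℕ} (hs : 2 ≤ s) :
    (Nat.nth Nat.Prime (s - 1) : ℝ) ≤ 60 * (s * Real.log s) := by
  have hprime := Nat.prime_nth_prime (s - 1)
  have hcount : Nat.primeCounting (Nat.nth Nat.Prime (s - 1)) = s := by
    rw [Nat.primeCounting, Nat.primeCounting', Nat.count_nth_succ_of_infinite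
      Nat.infinite_setOfPred_prime]
    lia
  refine le_mul_log_of_le_mul_log (by exact_mod_cast hs) (by exact_mod_cast hprime.pos) ?_
  simpa only [hcount] using le_six_mul_primeCounting_mul_log hprime.two_le

theorem exists_primes_le_mul_log {n d : ℕ} (hn : 1 ≤ n) (hd : 1 ≤ d) :
    ∃ e : Fin n → ℕ, (∀ j, d < e j) ∧ (∀ j, (e j).Prime) ∧ Function.Injective e ∧
      ∀ j, (e j : ℝ) ≤ 60 * ((n + d : ℝ) * Real.log (n + d)) := by
  have hmono : StrictMono (Nat.nth Nat.Prime) := Nat.nth_strictMono Nat.infinite_setOfPred_prime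
  refine ⟨fun j => Nat.nth Nat.Prime (d + j), fun j => ?_, fun j => Nat.prime_nth_prime _,
    fun i j hij => Fin.ext (Nat.add_left_cancel (hmono.injective hij)), fun j => ?_⟩
  · exact (by lia : d < d + j + 2).trans_le (Nat.add_two_le_nth_prime (d + j))
  · have hle : Nat.nth Nat.Prime (d + j) ≤ Nat.nth Nat.Prime (n + d - 1) :=
      hmono.monotone (by lia)
    exact_mod_cast (Nat.cast_le.mpr hle).trans (nth_prime_le_mul_log (s := n + d) (by lia))

end Universal

end ExplicitNoether

theorem mainTheorem4 :
    -- finiteness of the restricted map, for every choice of the exponents and of the matrix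
    (∀ (F : Type*) [Field F] (n d m k : ℕ), 1 ≤ n → 1 ≤ d → 1 ≤ m → m ≤ n → 1 ≤ k → k ≤ n →
      ∀ e : Fin n → ℕ, (∀ j, d < e j) → Pairwise (fun i j => Nat.Coprime (e i) (e j)) →
      ∀ M : Matrix (Fin m) (Fin n) F, ExplicitNoether.IsRegularMatrix k M →
      ∀ V : Set (Fin n → AlgebraicClosure F), ExplicitNoether.IsAffineVariety F V →
        ExplicitNoether.affineDim F V ≤ (k : WithBot ℕ∞) →
        ExplicitNoether.affineDegree V ≤ (d : ℕ∞) →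
        ExplicitNoether.RestrictsToFinite (ExplicitNoether.dklPoly M e) V) ∧
    -- a universal map `𝔸ⁿ → 𝔸ᵏ` of degree `O((n + d) log (n + d))`, whenever `F` has `n` distinct
    -- elements `ω`, given by the Vandermonde matrix of `ω`
    (∃ C : ℝ, 0 < C ∧ ∀ n d : ℕ, 1 ≤ n → 1 ≤ d →
      ∃ e : Fin n → ℕ, (∀ j, d < e j) ∧ Pairwise (fun i j => Nat.Coprime (e i) (e j)) ∧
        ∀ (F : Type*) [Field F] (k : ℕ), 1 ≤ k → k ≤ n →
        ∀ ω : Fin n → F, Function.Injective ω →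
          ExplicitNoether.IsRegularMatrix k (ExplicitNoether.vandermondeMatrix k ω) ∧
          (∀ i, ((ExplicitNoether.dklPoly (ExplicitNoether.vandermondeMatrix k ω) e i).totalDegree : ℝ)
            ≤ C * ((n + d : ℝ) * Real.log (n + d))) ∧
          ∀ V : Set (Fin n → AlgebraicClosure F), ExplicitNoether.IsAffineVariety F V →
            ExplicitNoether.affineDim F V ≤ (k : WithBot ℕ∞) →
            ExplicitNoether.affineDegree V ≤ (d : ℕ∞) →
            ExplicitNoether.RestrictsToFinite
              (ExplicitNoether.dklPoly (ExplicitNoether.vandermondeMatrix k ω) e) V) := by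
  refine ⟨?_, 60, by norm_num, fun n d hn hd => ?_⟩
  · intro F _ n d m k _ _ _ _ _ hk e he hcop M hM V hV hdim hdeg
    exact ExplicitNoether.restrictsToFinite_dklPoly hk he hcop hM hV hdim hdeg
  obtain ⟨e, he, hprime, hinj, hle⟩ := ExplicitNoether.exists_primes_le_mul_log hn hd
  have hcop : Pairwise fun i j => Nat.Coprime (e i) (e j) := fun i j hij =>
    (Nat.coprime_primes (hprime i) (hprime j)).mpr (hinj.ne hij)
  have hbound : 0 ≤ 60 * ((n + d : ℝ) * Real.log (n + d)) :=
    (Nat.cast_nonneg _).trans (hle ⟨0, hn⟩)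
  refine ⟨e, he, hcop, fun F _ k _ hk ω hω => ?_⟩
  have hreg := ExplicitNoether.isRegularMatrix_vandermondeMatrix k hω
  refine ⟨hreg, fun i => ?_, fun V hV hdim hdeg =>
    ExplicitNoether.restrictsToFinite_dklPoly hk he hcop hreg hV hdim hdeg⟩
  exact (Nat.le_floor_iff hbound).mp
    (ExplicitNoether.totalDegree_dklPoly_le _ (fun j => Nat.le_floor (hle j)) i)
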